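/- Let $K$ be an imaginary quadratic field with ring of integers $\mathcal{O}_K$ and discriminant $D_K$, let $\ell\geq 3$ be a prime, and let $c\geq 1$ be an integer coprime to $\ell$. For $d\geq 0$ let $\mathcal{O}_d=\mathbf{Z}+c\ell^d\mathcal{O}_K$ be the order of conductor $c\ell^d$ in $K$, and let $S_d=\operatorname{Cl}(\mathcal{O}_d)[\ell^\infty]$ be the Sylow $\ell$-subgroup of its ideal class group (invertible, equivalently proper, fractional $\mathcal{O}_d$-ideals modulo principal ones). For a finite abelian $\ell$-group $S$ let $\operatorname{rk}(S)=\dim_{\mathbf{F}_\ell}S[\ell]$. (a) If $\ell$ is split or inert in $\mathcal{O}_K$, then $\operatorname{rk}(S_1)=\operatorname{rk}(S_0)$, $\operatorname{rk}(S_2)\in\{\operatorname{rk}(S_0),\operatorname{rk}(S_0)+1\}$, and $\operatorname{rk}(S_d)=\operatorname{rk}(S_2)$ for all $d\geq 2$. (b) If $\ell$ is ramified in $\mathcal{O}_K$ and either $\ell\geq 5$, or $\ell=3$ and $D_K\equiv 3\pmod 9$, then $\operatorname{rk}(S_1)\in\{\operatorname{rk}(S_0),\operatorname{rk}(S_0)+1\}$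 and $\operatorname{rk}(S_d)=\operatorname{rk}(S_1)$ for all $d\geq 1$. (c) If $\ell=3$ is ramified in $\mathcal{O}_K$ and $D_K\equiv 6\pmod 9$, then $\operatorname{rk}(S_1)\in\{\operatorname{rk}(S_0),\operatorname{rk}(S_0)+1\}$, $\operatorname{rk}(S_2)\in\{\operatorname{rk}(S_1),\operatorname{rk}(S_1)+1\}$, and $\operatorname{rk}(S_d)=\operatorname{rk}(S_2)$ for all $d\geq 2$. -/

import Mathlib

noncomputable section

namespace QuadraticClassGroup

/-- The order `ℤ + m 𝓞_K` of conductor `m` in the ring of integers of a quadratic field `K`. -/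
def order (K : Type*) [Field K] (m : ℕ) : Subalgebra ℤ (NumberField.RingOfIntegers K) where
  carrier := {x | ∃ (a : ℤ) (y : NumberField.RingOfIntegers K),
    x = (a : NumberField.RingOfIntegers K) + (m : NumberField.RingOfIntegers K) * y}
  mul_mem' := by
    rintro _ _ ⟨a, y, rfl⟩ ⟨b, z, rfl⟩
    refine ⟨a * b, a * z + b * y + m * y * z, ?_⟩
    push_cast
    ring
  add_mem' := by
    rintro _ _ ⟨a, y, rfl⟩ ⟨b, z, rfl⟩
    refine ⟨a + b, y + z, ?_⟩
    push_cast
    ring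
  algebraMap_mem' := fun a => ⟨a, 0, by simp⟩

/-- The Sylow `ℓ`-subgroup `S_d = Cl(𝓞_d)[ℓ^∞]` of the class group of the order `𝓞_d` of
conductor `c ℓ ^ d`. The class group consists of the invertible fractional ideals modulo the
principal ones; for orders in quadratic fields, the invertible fractional ideals are exactly the
proper ones. -/
abbrev S (K : Type*) [Field K] (ℓ c d : ℕ) [Fact ℓ.Prime] :
    Subgroup (ClassGroup (order K (c * ℓ ^ d))) :=
  CommGroup.primaryComponent (ClassGroup (order K (c * ℓ ^ d))) ℓ

/-- The rank of an abelian `ℓ`-group `A` (written multiplicatively): the dimension of the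
`ℓ`-torsion `A[ℓ]` as a vector space over `𝔽_ℓ`. -/
def rk (ℓ : ℕ) (A : Type*) [CommGroup A] : ℕ :=
  letI := AddSubgroup.torsionBy.zmodModule (A := Additive A) (n := ℓ)
  Module.finrank (ZMod ℓ) (AddSubgroup.torsionBy (Additive A) (ℓ : ℤ))

/-- The rational prime `ℓ` splits in the quadratic field `K`. -/
def IsSplit (K : Type*) [Field K] (ℓ : ℕ) : Prop :=
  ∃ P Q : Ideal (NumberField.RingOfIntegers K), P.IsPrime ∧ Q.IsPrime ∧ P ≠ Q ∧
    Ideal.span {(ℓ : NumberField.RingOfIntegers K)} = P * Q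

/-- The rational prime `ℓ` is inert in the quadratic field `K`. -/
def IsInert (K : Type*) [Field K] (ℓ : ℕ) : Prop :=
  (Ideal.span {(ℓ : NumberField.RingOfIntegers K)}).IsPrime

/-- The rational prime `ℓ` ramifies in the quadratic field `K`. -/
def IsRamified (K : Type*) [Field K] (ℓ : ℕ) : Prop :=
  ∃ P : Ideal (NumberField.RingOfIntegers K), P.IsPrime ∧
    Ideal.span {(ℓ : NumberField.RingOfIntegers K)} = P ^ 2

end QuadraticClassGroup

end

/-! Put A = ℤ + ℓB for consecutive orders A ⊂ B. Extension of ideals maps Cl(A) onto Cl(B)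
(`extendClass_surjective`), and every class in the kernel is that of a lattice ℤu + ℓB with u a unit
modulo ℓB (`exists_of_extendClass_eq_one`). Since ℓ^rk = [G : G^ℓ], the rank is unchanged when the
kernel consists of ℓ-th powers, and grows by at most one when the kernel is contained in a cyclic
group (`rk_eq_of_ker_le`, `rk_eq_or_of_ker_le`).

Three computations then suffice. If ℓ is unramified and prime to the conductor of B, then u^(ℓ²) ≡ u
mod ℓB, so the kernel consists of ℓ-th powers. If B is spanned modulo ℓB by 1 and τ with τ² ∈ ℓB,
every unit is, up to integers, a power of 1 + τ, so the kernel is cyclic; this covers a ramified ℓ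
and every conductor divisible by ℓ. Finally, for A ⊂ B ⊂ C with such a τ in C, a congruence (1 +
τ)^ℓ ≡ 1 + kℓτ mod ℓ²C with ℓ ∤ k makes the generator 1 + ℓτ of the kernel over B an ℓ-th power in
Cl(A) (`rk_step_eq_of_pow_eq`). The congruence holds with k = 1 when τ^ℓ ∈ ℓ²C; only ℓ = 3 ramified
at the bottom level needs the discriminant modulo 9. -/

namespace QuadraticClassGroup

open Submodule

/-! ### Lattices in K: products, units modulo m, descent to ℤ + pB. -/

section Lattice

variable {K : Type*} [Field K]

theorem mem_span_sup {u x : K} {N : Submodule ℤ K} :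
    x ∈ span ℤ {u} ⊔ N ↔ ∃ n : ℤ, x - n * u ∈ N := by
  rw [mem_sup]
  constructor
  · rintro ⟨y, hy, z, hz, rfl⟩
    obtain ⟨n, rfl⟩ := mem_span_singleton.1 hy
    exact ⟨n, by simpa using hz⟩
  · rintro ⟨n, hn⟩
    exact ⟨n * u, mem_span_singleton.2 ⟨n, by simp⟩, _, hn, by ring⟩

theorem mem_one_sup {x : K} {N : Submodule ℤ K} :
    x ∈ (1 : Submodule ℤ K) ⊔ N ↔ ∃ n : ℤ, x - n ∈ N := by
  rw [one_eq_span, mem_span_sup]; simp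

theorem mem_span_mul {p x : K} {N : Submodule ℤ K} :
    x ∈ span ℤ {p} * N ↔ ∃ y ∈ N, x = p * y := by
  rw [mem_span_singleton_mul]; simp only [eq_comm]

theorem mul_mem_of_mul_eq {I A : Submodule ℤ K} (h : I * A = I) {x a : K} (hx : x ∈ I)
    (ha : a ∈ A) : x * a ∈ I := h ▸ mul_mem_mul hx ha

theorem intCast_mem_of_one_mem {B : Submodule ℤ K} (h : (1 : K) ∈ B) (n : ℤ) : (n : K) ∈ B := by
  simpa using B.smul_mem n h

theorem intCast_mul_mem {B : Submodule ℤ K} {x : K} (h : x ∈ B) (n : ℤ) : (n : K) * x ∈ B := by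
  simpa using B.smul_mem n h

/-- A multiplicatively closed lattice containing `1`. -/
structure IsRingLattice (B : Submodule ℤ K) : Prop where
  one_mem : (1 : K) ∈ B
  mul_mem : ∀ {x y : K}, x ∈ B → y ∈ B → x * y ∈ B

namespace IsRingLattice

variable {B : Submodule ℤ K} (hB : IsRingLattice B)
include hB

theorem mul_self : B * B = B :=
  le_antisymm (mul_le.2 fun _ hx _ hy => hB.mul_mem hx hy) fun x hx => by
    simpa using mul_mem_mul hx hB.one_mem

theorem int_mem (n : ℤ) : (n : K) ∈ B := intCast_mem_of_one_mem hB.one_mem n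

theorem nat_mem (n : ℕ) : (n : K) ∈ B := by simpa using hB.int_mem n

theorem pow_mem {x : K} (hx : x ∈ B) (n : ℕ) : x ^ n ∈ B := by
  induction n with
  | zero => simpa using hB.one_mem
  | succ n ih => rw [pow_succ]; exact hB.mul_mem ih hx

theorem smul_mem_right {m x y : K} (hx : x ∈ span ℤ {m} * B) (hy : y ∈ B) :
    x * y ∈ span ℤ {m} * B := by
  obtain ⟨b, hb, rfl⟩ := mem_span_mul.1 hx
  exact mem_span_mul.2 ⟨b * y, hB.mul_mem hb hy, by ring⟩

theorem smul_mem_left {m x y : K} (hx : x ∈ span ℤ {m} * B) (hy : y ∈ B) :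
    y * x ∈ span ℤ {m} * B := mul_comm x y ▸ hB.smul_mem_right hx hy

theorem span_mul_le (n : ℕ) : span ℤ {(n : K)} * B ≤ B := by
  intro x hx
  obtain ⟨b, hb, rfl⟩ := mem_span_mul.1 hx
  exact hB.mul_mem (hB.nat_mem n) hb

theorem one_sup (n : ℕ) : IsRingLattice (1 ⊔ span ℤ {(n : K)} * B) where
  one_mem := mem_one_sup.2 ⟨1, by simp⟩
  mul_mem := by
    intro x y hx hy
    obtain ⟨a, ha⟩ := mem_one_sup.1 hx
    obtain ⟨b, hb⟩ := mem_one_sup.1 hy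
    refine mem_one_sup.2 ⟨a * b, ?_⟩
    have h1 : x * y - ((a * b : ℤ) : K) = (x - a) * (y - b) + (a * (y - b) + b * (x - a)) := by
      push_cast; ring
    rw [h1]
    exact add_mem (hB.smul_mem_right ha (hB.span_mul_le n hb))
      (add_mem (hB.smul_mem_left hb (hB.int_mem a)) (hB.smul_mem_left ha (hB.int_mem b)))

end IsRingLattice

/-- The elements of a ring lattice `B` that are invertible modulo `m`. -/
def IsUnitMod (B : Submodule ℤ K) (m : ℕ) (u : K) : Prop :=
  u ∈ B ∧ ∃ v ∈ B, u * v - 1 ∈ span ℤ {(m : K)} * B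

/-- The lattice generated by `u` and `m B`. -/
def unitLattice (B : Submodule ℤ K) (m : ℕ) (u : K) : Submodule ℤ K :=
  span ℤ {u} ⊔ span ℤ {(m : K)} * B

theorem IsUnitMod.mul {B : Submodule ℤ K} (hB : IsRingLattice B) {m : ℕ} {u v : K}
    (hu : IsUnitMod B m u) (hv : IsUnitMod B m v) : IsUnitMod B m (u * v) := by
  obtain ⟨hu, u', hu', h1⟩ := hu
  obtain ⟨hv, v', hv', h2⟩ := hv
  refine ⟨hB.mul_mem hu hv, u' * v', hB.mul_mem hu' hv', ?_⟩
  have : u * v * (u' * v') - 1 = (u * u' - 1) * (v * v') + (v * v' - 1) := by ring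
  rw [this]
  exact add_mem (hB.smul_mem_right h1 (hB.mul_mem hv hv')) h2

theorem IsUnitMod.one {B : Submodule ℤ K} (hB : IsRingLattice B) {m : ℕ} : IsUnitMod B m 1 :=
  ⟨hB.one_mem, 1, hB.one_mem, by simp⟩

theorem IsUnitMod.pow {B : Submodule ℤ K} (hB : IsRingLattice B) {m : ℕ} {u : K}
    (hu : IsUnitMod B m u) (n : ℕ) : IsUnitMod B m (u ^ n) := by
  induction n with
  | zero => simpa using IsUnitMod.one hB
  | succ n ih => rw [pow_succ]; exact ih.mul hB hu

/-- The product contains mB because u has an inverse u' modulo m: x = u(u'x) - (uu' - 1)x, where for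
x ∈ mB the last term lies in mB · mB. -/
theorem unitLattice_mul {B : Submodule ℤ K} (hB : IsRingLattice B) {m : ℕ} {u v : K}
    (hu : IsUnitMod B m u) (hv : IsUnitMod B m v) :
    unitLattice B m u * unitLattice B m v = unitLattice B m (u * v) := by
  obtain ⟨hu, u', hu', h1⟩ := hu
  have hv := hv.1
  apply le_antisymm
  · refine mul_le.2 fun x hx y hy => ?_
    obtain ⟨a, ha⟩ := mem_span_sup.1 hx
    obtain ⟨b, hb⟩ := mem_span_sup.1 hy
    refine mem_span_sup.2 ⟨a * b, ?_⟩
    have h : x * y - ((a * b : ℤ) : K) * (u * v) =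
        (x - a * u) * (y - b * v) + ((a * u) * (y - b * v) + (b * v) * (x - a * u)) := by
      push_cast; ring
    rw [h]
    exact add_mem (hB.smul_mem_right ha (hB.span_mul_le m hb))
      (add_mem (hB.smul_mem_left hb (hB.mul_mem (hB.int_mem a) hu))
        (hB.smul_mem_left ha (hB.mul_mem (hB.int_mem b) hv)))
  · refine sup_le ?_ ?_
    · rw [span_singleton_le_iff_mem]
      exact mul_mem_mul (mem_sup_left (mem_span_singleton_self u))
        (mem_sup_left (mem_span_singleton_self v))
    · intro x hx
      have h2 : x = u * (u' * x) - (u * u' - 1) * x := by ring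
      obtain ⟨c, hc, hc'⟩ := mem_span_mul.1 h1
      rw [h2]
      refine sub_mem (mul_mem_mul (mem_sup_left (mem_span_singleton_self u))
        (mem_sup_right (hB.smul_mem_left hx hu'))) ?_
      rw [hc']
      have h3 : (m : K) * c * x = m * (c * x) := by ring
      refine mul_mem_mul (mem_sup_right (mem_span_mul.2 ⟨c, hc, rfl⟩)) (mem_sup_right hx)

theorem unitLattice_mul_one_sup {B : Submodule ℤ K} (hB : IsRingLattice B) {m : ℕ} {u : K}
    (hu : IsUnitMod B m u) :
    unitLattice B m u * (1 ⊔ span ℤ {(m : K)} * B) = unitLattice B m u := by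
  have := unitLattice_mul hB hu (IsUnitMod.one hB)
  rwa [unitLattice, unitLattice, ← one_eq_span, mul_one] at this

theorem exists_inverse_unitLattice {B : Submodule ℤ K} (hB : IsRingLattice B) {m : ℕ} {u : K}
    (hu : IsUnitMod B m u) : ∃ v, IsUnitMod B m v ∧
    unitLattice B m u * unitLattice B m v = 1 ⊔ span ℤ {(m : K)} * B := by
  obtain ⟨v, hv, h⟩ := hu.2
  have hv' : IsUnitMod B m v := ⟨hv, u, hu.1, mul_comm u v ▸ h⟩
  refine ⟨v, hv', ?_⟩
  rw [unitLattice_mul hB hu hv', unitLattice, one_eq_span]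
  have h1 : u * v ∈ span ℤ {(1 : K)} ⊔ span ℤ {(m : K)} * B := mem_span_sup.2 ⟨1, by simpa using h⟩
  have h2 : (1 : K) ∈ span ℤ {u * v} ⊔ span ℤ {(m : K)} * B :=
    mem_span_sup.2 ⟨1, by simpa using neg_mem h⟩
  exact le_antisymm (sup_le ((span_singleton_le_iff_mem _ _).2 h1) le_sup_right)
    (sup_le ((span_singleton_le_iff_mem _ _).2 h2) le_sup_right)

/-- The lattice sees u only modulo mB and up to integer factors invertible modulo m. -/
theorem unitLattice_congr {B : Submodule ℤ K} {m : ℕ} {u v : K} (a b : ℤ)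
    (h1 : u - a * v ∈ span ℤ {(m : K)} * B) (h2 : v - b * u ∈ span ℤ {(m : K)} * B) :
    unitLattice B m u = unitLattice B m v :=
  le_antisymm (sup_le ((span_singleton_le_iff_mem _ _).2 (mem_span_sup.2 ⟨a, h1⟩)) le_sup_right)
    (sup_le ((span_singleton_le_iff_mem _ _).2 (mem_span_sup.2 ⟨b, h2⟩)) le_sup_right)

theorem unitLattice_eq_of_sub_mem {B : Submodule ℤ K} {m : ℕ} {u v : K}
    (h : u - v ∈ span ℤ {(m : K)} * B) : unitLattice B m u = unitLattice B m v :=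
  unitLattice_congr 1 1 (by simpa using h) (by simpa using neg_mem h)

/-- Invertible ideals of `ℤ + p B` that extend to `B` are generated by a unit modulo `p` and
`p B`. -/
theorem exists_eq_unitLattice {B I J : Submodule ℤ K} (hB : IsRingLattice B) {p : ℕ}
    (hp : p.Prime) (h1 : (1 : K) ∉ span ℤ {(p : K)} * B)
    (hI : I * (1 ⊔ span ℤ {(p : K)} * B) = I)
    (hIJ : I * J = 1 ⊔ span ℤ {(p : K)} * B) (hIB : I * B = B) :
    ∃ u, IsUnitMod B p u ∧ I = unitLattice B p u := by
  set A := 1 ⊔ span ℤ {(p : K)} * B with hA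
  have hAB : A * B = B := by
    refine le_antisymm ?_ fun x hx => ?_
    · exact (mul_le_mul_left (sup_le (by rw [Submodule.one_le]; exact hB.one_mem) (hB.span_mul_le p)) _).trans
        hB.mul_self.le
    · simpa using mul_mem_mul ((hB.one_sup p).one_mem) hx
  have hJB : J * B = B := by
    calc J * B = J * (I * B) := by rw [hIB]
      _ = A * B := by rw [← hIJ, mul_comm I J, mul_assoc]
      _ = B := hAB
  have hIle : I ≤ B := fun x hx => by simpa [hIB] using mul_mem_mul hx hB.one_mem
  have hJle : J ≤ B := fun x hx => by simpa [hJB] using mul_mem_mul hx hB.one_mem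
  have hpI : span ℤ {(p : K)} * B ≤ I := by
    calc span ℤ {(p : K)} * B = I * (span ℤ {(p : K)} * B) := by
          rw [mul_left_comm, hIB]
      _ ≤ I * A := mul_le_mul_right le_sup_right _
      _ = I := hI
  -- Some product ij avoids pB, since 1 ∈ IJ. It is congruent to an integer n prime to p, so i is a
  -- unit modulo p and will be the generator.
  obtain ⟨i, hi, j, hj, hij⟩ : ∃ i ∈ I, ∃ j ∈ J, i * j ∉ span ℤ {(p : K)} * B := by
    by_contra! h
    exact h1 (mul_le.2 h (hIJ ▸ (hB.one_sup p).one_mem))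
  obtain ⟨n, hn⟩ := mem_one_sup.1 (hIJ ▸ mul_mem_mul hi hj : i * j ∈ A)
  have hpn : ¬ (p : ℤ) ∣ n := by
    rintro ⟨k, rfl⟩
    apply hij
    have : i * j = (i * j - ((p * k : ℤ) : K)) + p * k := by push_cast; ring
    rw [this]
    exact add_mem hn (mem_span_mul.2 ⟨k, hB.int_mem k, rfl⟩)
  obtain ⟨k, m, hkm⟩ : IsCoprime (p : ℤ) n :=
    (Nat.prime_iff_prime_int.1 hp).irreducible.coprime_iff_not_dvd.2 hpn
  have hkm' : (m : K) * n = 1 - k * p := by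
    rw [eq_sub_iff_add_eq, add_comm]; simpa using congrArg (Int.cast : ℤ → K) hkm
  have hv : i * (m * j) - 1 ∈ span ℤ {(p : K)} * B := by
    have : i * (m * j) - 1 = m * (i * j - n) - p * k := by
      linear_combination hkm'
    rw [this]
    exact sub_mem (hB.smul_mem_left hn (hB.int_mem m)) (mem_span_mul.2 ⟨k, hB.int_mem k, rfl⟩)
  refine ⟨i, ⟨hIle hi, m * j, hB.mul_mem (hB.int_mem m) (hJle hj), hv⟩, le_antisymm ?_ ?_⟩
  · intro x hx
    obtain ⟨n', hn'⟩ := mem_one_sup.1 (hIJ ▸ mul_mem_mul hx hj : x * j ∈ A)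
    refine mem_span_sup.2 ⟨m * n', ?_⟩
    have : x - ((m * n' : ℤ) : K) * i = m * i * (x * j - n') - x * (i * (m * j) - 1) := by
      push_cast; ring
    rw [this]
    exact sub_mem (hB.smul_mem_left hn' (hB.mul_mem (hB.int_mem m) (hIle hi)))
      (hB.smul_mem_left hv (hIle hx))
  · exact sup_le ((span_singleton_le_iff_mem _ _).2 hi) hpI

/-- An invertible ideal `I` of `B` with a local generator `y` at `p` descends to `ℤ + p B`. -/
theorem descend_lattice_mul_inverse {B I I' : Submodule ℤ K} (hB : IsRingLattice B) {p : ℕ}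
    (hI' : I' * B = I') (hII' : I * I' = B)
    {y y' : K} (hy : y ∈ I) (hy' : y' ∈ I') (h : y * y' - 1 ∈ span ℤ {(p : K)} * B) :
    (span ℤ {y} ⊔ span ℤ {(p : K)} * I) * (span ℤ {y'} ⊔ span ℤ {(p : K)} * I') =
      1 ⊔ span ℤ {(p : K)} * B := by
  obtain ⟨b, hb, hb'⟩ := mem_span_mul.1 h
  apply le_antisymm
  · refine mul_le.2 fun x hx z hz => ?_
    obtain ⟨a, ha⟩ := mem_span_sup.1 hx
    obtain ⟨c, hc⟩ := mem_span_sup.1 hz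
    obtain ⟨e, he, he'⟩ := mem_span_mul.1 ha
    obtain ⟨f, hf, hf'⟩ := mem_span_mul.1 hc
    refine mem_one_sup.2 ⟨a * c, mem_span_mul.2
      ⟨a * c * b + (a * (y * f) + c * (e * y') + p * (e * f)), ?_, ?_⟩⟩
    · have key : ∀ {s t : K}, s ∈ I → t ∈ I' → s * t ∈ B := fun hs ht => hII' ▸ mul_mem_mul hs ht
      exact add_mem (hB.mul_mem (hB.mul_mem (hB.int_mem a) (hB.int_mem c)) hb)
        (add_mem (add_mem (hB.mul_mem (hB.int_mem a) (key hy hf))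
          (hB.mul_mem (hB.int_mem c) (key he hy'))) (hB.mul_mem (hB.nat_mem p) (key he hf)))
    · rw [eq_add_of_sub_eq he', eq_add_of_sub_eq hf']
      push_cast
      linear_combination (a * c : K) * hb'
  · have hy1 : y ∈ span ℤ {y} ⊔ span ℤ {(p : K)} * I := mem_sup_left (mem_span_singleton_self y)
    have hy2 : y' ∈ span ℤ {y'} ⊔ span ℤ {(p : K)} * I' := mem_sup_left (mem_span_singleton_self _)
    have hpB : span ℤ {(p : K)} * B ≤
        (span ℤ {y} ⊔ span ℤ {(p : K)} * I) * (span ℤ {y'} ⊔ span ℤ {(p : K)} * I') := by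
      -- p²B = (pI)(pI') lies in the product; with yy' = 1 + pb, the identity pz = y · p(y'z) -
      -- p²(bz) then brings in all of pB.
      have h2 : ∀ x ∈ B, (p : K) * p * x ∈
          (span ℤ {y} ⊔ span ℤ {(p : K)} * I) * (span ℤ {y'} ⊔ span ℤ {(p : K)} * I') := by
        intro x hx
        rw [← hII'] at hx
        refine Submodule.mul_induction_on hx (fun s hs t ht => ?_) fun s t hs ht => ?_
        · have : (p : K) * p * (s * t) = (p * s) * (p * t) := by ring
          rw [this]
          exact mul_mem_mul (mem_sup_right (mem_span_mul.2 ⟨s, hs, rfl⟩))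
            (mem_sup_right (mem_span_mul.2 ⟨t, ht, rfl⟩))
        · rw [mul_add]; exact add_mem hs ht
      intro x hx
      obtain ⟨z, hz, rfl⟩ := mem_span_mul.1 hx
      have h3 : (p : K) * z = y * (p * (y' * z)) - p * p * (b * z) := by
        linear_combination -(p * z : K) * hb'
      rw [h3]
      exact sub_mem (mul_mem_mul hy1 (mem_sup_right
        (mem_span_mul.2 ⟨_, mul_mem_of_mul_eq hI' hy' hz, rfl⟩))) (h2 _ (hB.mul_mem hb hz))
    refine sup_le ?_ hpB
    rw [Submodule.one_le]
    have : (1 : K) = y * y' - (y * y' - 1) := by ring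
    rw [this]
    exact sub_mem (mul_mem_mul hy1 hy2) (hpB h)

theorem descend_lattice_mul_order {B I : Submodule ℤ K} (hB : IsRingLattice B) {p : ℕ}
    (hI : I * B = I) {y : K} (hy : y ∈ I) :
    (span ℤ {y} ⊔ span ℤ {(p : K)} * I) * (1 ⊔ span ℤ {(p : K)} * B) =
      span ℤ {y} ⊔ span ℤ {(p : K)} * I := by
  apply le_antisymm
  · refine mul_le.2 fun x hx z hz => ?_
    obtain ⟨a, ha⟩ := mem_span_sup.1 hx
    obtain ⟨c, hc⟩ := mem_one_sup.1 hz
    obtain ⟨e, he, he'⟩ := mem_span_mul.1 ha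
    obtain ⟨f, hf, hf'⟩ := mem_span_mul.1 hc
    refine mem_span_sup.2 ⟨a * c, mem_span_mul.2 ⟨a * (y * f) + c * e + p * (e * f), ?_, ?_⟩⟩
    · exact add_mem (add_mem (intCast_mul_mem (mul_mem_of_mul_eq hI hy hf) a)
        (intCast_mul_mem he c)) (by simpa using intCast_mul_mem (mul_mem_of_mul_eq hI he hf) p)
    · rw [eq_add_of_sub_eq he', eq_add_of_sub_eq hf']
      push_cast
      ring
  · intro x hx
    simpa using mul_mem_mul hx ((hB.one_sup p).one_mem)

theorem descend_lattice_mul {B I I' : Submodule ℤ K} {p : ℕ}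
    (hI : I * B = I) (hII' : I * I' = B) {y y' : K} (hy : y ∈ I) (hy' : y' ∈ I')
    (h : y * y' - 1 ∈ span ℤ {(p : K)} * B) :
    (span ℤ {y} ⊔ span ℤ {(p : K)} * I) * B = I := by
  obtain ⟨b, hb, hb'⟩ := mem_span_mul.1 h
  apply le_antisymm
  · refine (mul_le_mul_left (sup_le ((span_singleton_le_iff_mem _ I).2 hy) ?_) B).trans hI.le
    intro x hx
    obtain ⟨z, hz, rfl⟩ := mem_span_mul.1 hx
    simpa using intCast_mul_mem hz p
  · intro x hx
    have h3 : x = y * (x * y') - (p * x) * b := by linear_combination -x * hb'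
    rw [h3]
    exact sub_mem (mul_mem_mul (mem_sup_left (mem_span_singleton_self y))
      (hII' ▸ mul_mem_mul hx hy'))
      (mul_mem_mul (mem_sup_right (mem_span_mul.2 ⟨x, hx, rfl⟩)) hb)

end Lattice

end QuadraticClassGroup

namespace QuadraticClassGroup

open Submodule
open scoped nonZeroDivisors

/-! ### Class groups described by lattices, the extension map and its kernel. -/

section ClassGroup

variable (R A B K : Type*) [Field K] [CommRing R] [Algebra R K] [CommRing A] [Algebra A K]
  [CommRing B] [Algebra B K]

/-- The image of a ring in an algebra, as a lattice. -/
def lattice : Submodule ℤ K :=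
  (1 : Submodule R K).restrictScalars ℤ

variable {R K} in
theorem mem_lattice {x : K} : x ∈ lattice R K ↔ ∃ r : R, algebraMap R K r = x :=
  Submodule.mem_one

theorem isRingLattice_lattice :
    IsRingLattice (lattice R K) where
  one_mem := mem_lattice.2 ⟨1, map_one _⟩
  mul_mem := by
    intro x y hx hy
    obtain ⟨r, rfl⟩ := mem_lattice.1 hx
    obtain ⟨s, rfl⟩ := mem_lattice.1 hy
    exact mem_lattice.2 ⟨r * s, map_mul _ _ _⟩

/-- A lattice that is stable under `R`, as an `R`-module. -/
def ofLattice (I : Submodule ℤ K) (h : I * lattice R K = I) : Submodule R K where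
  __ := I.toAddSubmonoid
  smul_mem' r x hx := by
    rw [Algebra.smul_def, mul_comm]
    exact mul_mem_of_mul_eq h hx (mem_lattice.2 ⟨r, rfl⟩)

variable {R K} in
@[simp]
theorem restrictScalars_ofLattice (I : Submodule ℤ K) (h : I * lattice R K = I) :
    (ofLattice R K I h).restrictScalars ℤ = I := rfl

variable {R K} in
theorem restrictScalars_mul_lattice (I : Submodule R K) :
    I.restrictScalars ℤ * lattice R K = I.restrictScalars ℤ := by
  rw [lattice, ← Submodule.restrictScalars_mul, mul_one]

variable {R K} in
theorem exists_unit_of_lattice {I J : Submodule ℤ K} (hI : I * lattice R K = I)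
    (hJ : J * lattice R K = J) (hIJ : I * J = lattice R K) :
    ∃ U : (Submodule R K)ˣ, (U : Submodule R K).restrictScalars ℤ = I := by
  refine ⟨Units.mkOfMulEqOne (ofLattice R K I hI) (ofLattice R K J hJ) ?_, rfl⟩
  apply Submodule.restrictScalars_injective ℤ R K
  rw [Submodule.restrictScalars_mul]
  exact hIJ

/-- Extension of submodules of the fraction field to a larger ring. -/
def extendSubmodule (h : lattice A K ≤ lattice B K) : Submodule A K →* Submodule B K where
  toFun I := ofLattice B K (I.restrictScalars ℤ * lattice B K) (by
    rw [mul_assoc, (isRingLattice_lattice B K).mul_self])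
  map_one' := by
    apply Submodule.restrictScalars_injective ℤ B K
    rw [restrictScalars_ofLattice]
    change lattice A K * lattice B K = lattice B K
    refine le_antisymm ?_ fun x hx => ?_
    · exact (mul_le_mul_left h _).trans (isRingLattice_lattice B K).mul_self.le
    · simpa using mul_mem_mul (isRingLattice_lattice A K).one_mem hx
  map_mul' I J := by
    apply Submodule.restrictScalars_injective ℤ B K
    rw [restrictScalars_ofLattice, Submodule.restrictScalars_mul, Submodule.restrictScalars_mul,
      restrictScalars_ofLattice, restrictScalars_ofLattice, mul_mul_mul_comm,
      (isRingLattice_lattice B K).mul_self]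

variable {A B K}

theorem restrictScalars_extendSubmodule (h : lattice A K ≤ lattice B K) (I : Submodule A K) :
    (extendSubmodule A B K h I).restrictScalars ℤ = I.restrictScalars ℤ * lattice B K := rfl

theorem restrictScalars_span_singleton (x : K) :
    (span R {x}).restrictScalars ℤ = span ℤ {x} * lattice R K := by
  ext y
  rw [restrictScalars_mem, mem_span_singleton, mem_span_mul]
  constructor
  · rintro ⟨r, rfl⟩
    exact ⟨_, mem_lattice.2 ⟨r, rfl⟩, by rw [Algebra.smul_def, mul_comm]⟩
  · rintro ⟨z, hz, rfl⟩
    obtain ⟨r, rfl⟩ := mem_lattice.1 hz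
    exact ⟨r, by rw [Algebra.smul_def, mul_comm]⟩

theorem extendSubmodule_span_singleton (h : lattice A K ≤ lattice B K) (x : K) :
    extendSubmodule A B K h (span A {x}) = span B {x} := by
  apply Submodule.restrictScalars_injective ℤ B K
  rw [restrictScalars_extendSubmodule, restrictScalars_span_singleton,
    restrictScalars_span_singleton, mul_assoc]
  congr 1
  exact congrArg (Submodule.restrictScalars ℤ) (map_one (extendSubmodule A B K h))

theorem lattice_le_of_eq {m : ℕ} (hA : lattice A K = 1 ⊔ span ℤ {(m : K)} * lattice B K) :
    lattice A K ≤ lattice B K := by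
  rw [hA]
  exact sup_le (by rw [Submodule.one_le]; exact (isRingLattice_lattice B K).one_mem)
    ((isRingLattice_lattice B K).span_mul_le m)

/-- The modulus m is arbitrary, so that A can be seen both as ℤ + ℓB and as ℤ + ℓ²C. -/
theorem exists_unit_unitLattice {Λ : Submodule ℤ K} (hΛ : IsRingLattice Λ) {m : ℕ}
    (hA : lattice A K = 1 ⊔ span ℤ {(m : K)} * Λ) {u : K} (hu : IsUnitMod Λ m u) :
    ∃ U : (Submodule A K)ˣ, (U : Submodule A K).restrictScalars ℤ = unitLattice Λ m u := by
  obtain ⟨v, hv, h⟩ := exists_inverse_unitLattice hΛ hu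
  exact exists_unit_of_lattice (hA ▸ unitLattice_mul_one_sup hΛ hu)
    (hA ▸ unitLattice_mul_one_sup hΛ hv) (hA ▸ h)

variable [IsDomain A] [IsFractionRing A K] [IsDomain B] [IsFractionRing B K]

variable (A K) in
/-- The class of an invertible submodule of the fraction field. -/
noncomputable def cls : (Submodule A K)ˣ →* ClassGroup A :=
  (ClassGroup.mk K).comp
    (FractionalIdeal.unitsMulEquivSubmodule (S := A⁰) (R := A) (P := K)).symm.toMonoidHom

variable (A K) in
theorem cls_surjective : Function.Surjective (cls A K) := by
  intro x
  refine ClassGroup.induction K (P := fun x => ∃ U, cls A K U = x) (fun I => ?_) x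
  exact ⟨FractionalIdeal.unitsMulEquivSubmodule I, by simp [cls]⟩

theorem cls_eq_one_iff {U : (Submodule A K)ˣ} :
    cls A K U = 1 ↔ (U : Submodule A K).IsPrincipal :=
  ClassGroup.mk_eq_one_iff

variable (A B K) in
/-- The homomorphism of class groups induced by an inclusion of orders. -/
noncomputable def extendClass (h : lattice A K ≤ lattice B K) : ClassGroup A →* ClassGroup B :=
  (cls A K).liftOfSurjective (cls_surjective A K)
    ⟨(cls B K).comp (Units.map (extendSubmodule A B K h)), fun U hU => by
      rw [MonoidHom.mem_ker, cls_eq_one_iff] at hU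
      obtain ⟨x, hx⟩ := hU
      rw [MonoidHom.mem_ker, MonoidHom.comp_apply, cls_eq_one_iff]
      exact ⟨x, by rw [Units.coe_map, hx]; exact extendSubmodule_span_singleton h x⟩⟩

theorem extendClass_cls (h : lattice A K ≤ lattice B K) (U : (Submodule A K)ˣ) :
    extendClass A B K h (cls A K U) = cls B K (Units.map (extendSubmodule A B K h) U) :=
  (cls A K).liftOfRightInverse_comp_apply _ _ _ _

open Classical in
variable (A) in
/-- The class of a lattice in `K` that is an invertible `A`-module. -/
noncomputable def latticeClass (I : Submodule ℤ K) : ClassGroup A :=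
  if h : ∃ U : (Submodule A K)ˣ, (U : Submodule A K).restrictScalars ℤ = I then
    cls A K h.choose else 1

theorem latticeClass_unit (U : (Submodule A K)ˣ) :
    latticeClass A ((U : Submodule A K).restrictScalars ℤ) = cls A K U := by
  have h : ∃ V : (Submodule A K)ˣ,
    (V : Submodule A K).restrictScalars ℤ = (U : Submodule A K).restrictScalars ℤ := ⟨U, rfl⟩
  rw [latticeClass, dif_pos h]
  congr 1
  exact Units.ext (Submodule.restrictScalars_injective ℤ A K h.choose_spec)

theorem latticeClass_unitLattice_mul {Λ : Submodule ℤ K} (hΛ : IsRingLattice Λ) {m : ℕ}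
    (hA : lattice A K = 1 ⊔ span ℤ {(m : K)} * Λ) {u v : K} (hu : IsUnitMod Λ m u)
    (hv : IsUnitMod Λ m v) :
    latticeClass A (unitLattice Λ m (u * v)) =
      latticeClass A (unitLattice Λ m u) * latticeClass A (unitLattice Λ m v) := by
  obtain ⟨U, hU⟩ := exists_unit_unitLattice hΛ hA hu
  obtain ⟨V, hV⟩ := exists_unit_unitLattice hΛ hA hv
  rw [← unitLattice_mul hΛ hu hv, ← hU, ← hV, ← Submodule.restrictScalars_mul, ← Units.val_mul,
    latticeClass_unit, latticeClass_unit, latticeClass_unit, map_mul]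

theorem latticeClass_unitLattice_one {Λ : Submodule ℤ K} {m : ℕ}
    (hA : lattice A K = 1 ⊔ span ℤ {(m : K)} * Λ) :
    latticeClass A (unitLattice Λ m 1) = 1 := by
  rw [unitLattice, ← one_eq_span, ← hA]
  exact (latticeClass_unit (1 : (Submodule A K)ˣ)).trans (map_one _)

theorem latticeClass_unitLattice_pow {Λ : Submodule ℤ K} (hΛ : IsRingLattice Λ) {m : ℕ}
    (hA : lattice A K = 1 ⊔ span ℤ {(m : K)} * Λ) {u : K} (hu : IsUnitMod Λ m u) (n : ℕ) :
    latticeClass A (unitLattice Λ m (u ^ n)) = latticeClass A (unitLattice Λ m u) ^ n := by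
  induction n with
  | zero => rw [pow_zero, pow_zero, latticeClass_unitLattice_one hA]
  | succ n ih =>
    rw [pow_succ, pow_succ, latticeClass_unitLattice_mul hΛ hA (hu.pow hΛ n) hu, ih]

/-- If the extension of U to B is generated by y, dividing U by y keeps its class and makes the
extension equal to B, so that `exists_eq_unitLattice` applies. -/
theorem exists_of_extendClass_eq_one {p : ℕ} (hp : p.Prime)
    (hA : lattice A K = 1 ⊔ span ℤ {(p : K)} * lattice B K)
    (h1 : (1 : K) ∉ span ℤ {(p : K)} * lattice B K) {x : ClassGroup A}
    (hx : extendClass A B K (lattice_le_of_eq hA) x = 1) :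
    ∃ u, IsUnitMod (lattice B K) p u ∧ latticeClass A (unitLattice (lattice B K) p u) = x := by
  obtain ⟨U, rfl⟩ := cls_surjective A K x
  rw [extendClass_cls, cls_eq_one_iff] at hx
  obtain ⟨y, hy⟩ := hx
  rw [Units.coe_map] at hy
  have hy0 : y ≠ 0 := by
    rintro rfl
    have h := congrArg Units.val
      (mul_inv_cancel (Units.map (extendSubmodule A B K (lattice_le_of_eq hA)) U))
    rw [Units.val_mul, Units.coe_map, Units.val_one] at h
    erw [hy] at h
    rw [Submodule.span_zero_singleton, bot_mul] at h
    exact one_ne_zero ((mem_bot B).1 ((Submodule.one_le (P := (⊥ : Submodule B K))).1 h.ge))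
  have hyy : span A {y} * span A {y⁻¹} = (1 : Submodule A K) := by
    rw [span_mul_span, Set.singleton_mul_singleton, mul_inv_cancel₀ hy0, ← one_eq_span]
  let Y : (Submodule A K)ˣ := Units.mkOfMulEqOne _ _ hyy
  have hY : cls A K Y = 1 := cls_eq_one_iff.2 ⟨y, rfl⟩
  have hV : cls A K (U * Y⁻¹) = cls A K U := by rw [map_mul, map_inv, hY, inv_one, mul_one]
  have hVB : ((U * Y⁻¹ : (Submodule A K)ˣ) : Submodule A K).restrictScalars ℤ * lattice B K =
      lattice B K := by
    rw [← restrictScalars_extendSubmodule (lattice_le_of_eq hA), Units.val_mul, map_mul]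
    erw [hy]
    rw [show ((Y⁻¹ : (Submodule A K)ˣ) : Submodule A K) = span A {y⁻¹} from rfl,
      extendSubmodule_span_singleton, span_mul_span, Set.singleton_mul_singleton,
      mul_inv_cancel₀ hy0, ← one_eq_span]
    rfl
  obtain ⟨u, hu, h⟩ := exists_eq_unitLattice
    (I := ((U * Y⁻¹ : (Submodule A K)ˣ) : Submodule A K).restrictScalars ℤ)
    (J := (((U * Y⁻¹)⁻¹ : (Submodule A K)ˣ) : Submodule A K).restrictScalars ℤ)
    (isRingLattice_lattice B K) hp h1 (hA ▸ restrictScalars_mul_lattice _)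
    (by rw [← hA, ← Submodule.restrictScalars_mul, Units.mul_inv]; rfl) hVB
  exact ⟨u, hu, by rw [← h, latticeClass_unit, hV]⟩

end ClassGroup

end QuadraticClassGroup

namespace QuadraticClassGroup

open Submodule

/-! ### Surjectivity of the extension map. -/

section Surjective

variable {A B K : Type*} [Field K] [CommRing A] [Algebra A K] [CommRing B] [Algebra B K]

theorem exists_mul_notMem [FaithfulSMul B K] {I I' : Submodule B K} (h : I * I' = 1) (M : Ideal B)
    (hM : M ≠ ⊤) : ∃ a ∈ I, ∃ b ∈ I', ∃ c ∉ M, algebraMap B K c = a * b := by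
  by_contra! hcon
  have hle : I * I' ≤ Submodule.map (Algebra.linearMap B K) M := by
    refine mul_le.2 fun a ha b hb => ?_
    obtain ⟨c, hc⟩ := Submodule.mem_one.1 (h ▸ mul_mem_mul ha hb)
    exact ⟨c, by_contra fun hcM => hcon a ha b hb c hcM hc, hc⟩
  obtain ⟨c, hc, hc'⟩ := hle (h ▸ Submodule.one_le.1 le_rfl)
  have : c = 1 := FaithfulSMul.algebraMap_injective B K (by simpa using hc')
  exact hM ((Ideal.eq_top_iff_one M).2 (this ▸ hc))

/-- Invertible ideals are principal over a semilocal ring: y is built to generate I at each of the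
finitely many maximal ideals M above p. Then yI' ⊆ B lies in no such M, so yI' + pB = B. -/
theorem exists_mul_sub_one_mem [FaithfulSMul B K] {I I' : Submodule B K} (h : I * I' = 1) (p : ℕ)
    (hfin : {M : Ideal B | M.IsMaximal ∧ (p : B) ∈ M}.Finite) :
    ∃ y ∈ I, ∃ y' ∈ I', y * y' - 1 ∈ span ℤ {(p : K)} * lattice B K := by
  classical
  set s := hfin.toFinset with hs
  have hmem : ∀ M ∈ s, M.IsMaximal ∧ (p : B) ∈ M := fun M hM => by simpa [hs] using hM
  have nle : ∀ M ∈ s, ¬⨅ M' ∈ s.erase M, M' ≤ M := fun M hM =>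
    left_lt_sup.1 ((hmem M hM).1.lt_top.trans_eq (Ideal.sup_iInf_eq_top fun M' hM' =>
      Ideal.IsMaximal.coprime_of_ne (hmem M hM).1 (hmem M' (Finset.mem_of_mem_erase hM')).1
        (Finset.ne_of_mem_erase hM').symm).symm)
  choose! a ha b hb c hc hab using fun M (hM : M ∈ s) =>
    exists_mul_notMem h M (hmem M hM).1.ne_top
  choose! u hu hum using fun M hM => SetLike.not_le_iff_exists.1 (nle M hM)
  -- u M lies in every maximal ideal of s except M, so y · b M ≡ u M · a M · b M modulo M, which is
  -- nonzero there.
  set y := ∑ M ∈ s, u M • a M with hy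
  have hyI : y ∈ I := Submodule.sum_mem _ fun M hM => Submodule.smul_mem _ _ (ha M hM)
  set J : Ideal B := Submodule.comap (Algebra.linearMap B K) (span B {y} * I') with hJ
  have htop : J ⊔ Ideal.span {(p : B)} = ⊤ := by
    by_contra hne
    obtain ⟨M, hM, hJM⟩ := Ideal.exists_le_maximal _ hne
    have hMs : M ∈ s := by
      simp only [hs, Set.Finite.mem_toFinset, Set.mem_ofPred_eq]
      exact ⟨hM, hJM (mem_sup_right (Ideal.mem_span_singleton_self _))⟩
    have hB : ∀ M' ∈ s, ∃ r : B, algebraMap B K r = a M' * b M := fun M' hM' =>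
      Submodule.mem_one.1 (h ▸ mul_mem_mul (ha M' hM') (hb M hMs))
    choose! r hr using hB
    have hsum : algebraMap B K (∑ M' ∈ s, u M' * r M') = y * b M := by
      rw [map_sum, hy, Finset.sum_mul]
      refine Finset.sum_congr rfl fun M' hM' => ?_
      rw [map_mul, hr M' hM', Algebra.smul_def, mul_assoc]
    have h1 : ∑ M' ∈ s, u M' * r M' ∈ M := by
      refine hJM (mem_sup_left ?_)
      rw [hJ, mem_comap, Algebra.linearMap_apply, hsum]
      exact mul_mem_mul (mem_span_singleton_self y) (hb M hMs)
    rw [← s.add_sum_erase _ hMs, Submodule.add_mem_iff_left] at h1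
    · rcases hM.isPrime.mem_or_mem h1 with h2 | h2
      · exact hum M hMs h2
      · refine hc M hMs ?_
        rwa [← FaithfulSMul.algebraMap_injective B K ((hr M hMs).trans (hab M hMs).symm)]
    · refine Submodule.sum_mem _ fun M' hM' => Ideal.mul_mem_right _ _ ?_
      have hMM' : M ∈ s.erase M' :=
        Finset.mem_erase.2 ⟨(Finset.ne_of_mem_erase hM').symm, hMs⟩
      exact (iInf₂_le M hMM' : _ ≤ M) (hu M' (Finset.mem_of_mem_erase hM'))
  obtain ⟨j, hj, q, hq, hjq⟩ := mem_sup.1 ((Ideal.eq_top_iff_one _).1 htop)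
  obtain ⟨t, rfl⟩ := Ideal.mem_span_singleton'.1 hq
  rw [hJ, mem_comap, Algebra.linearMap_apply, mem_span_singleton_mul] at hj
  obtain ⟨y', hy', hyy'⟩ := hj
  refine ⟨y, hyI, y', hy', mem_span_mul.2 ⟨-algebraMap B K t, neg_mem (mem_lattice.2 ⟨t, rfl⟩), ?_⟩⟩
  have h3 := congrArg (algebraMap B K) hjq
  rw [map_add, map_mul, map_natCast, map_one, ← hyy'] at h3
  linear_combination h3

/-- An ideal containing p is determined by its image in the finite ring B/pB. -/
theorem finite_maximal_of_finite_quotient (p : ℕ) [Finite (B ⧸ Ideal.span {(p : B)})] :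
    {M : Ideal B | M.IsMaximal ∧ (p : B) ∈ M}.Finite := by
  refine Set.Finite.of_injOn
    (f := fun M : Ideal B => ((Ideal.Quotient.mk (Ideal.span {(p : B)})) '' (M : Set B))) (t := Set.univ)
    (fun _ _ => Set.mem_univ _) ?_ Set.finite_univ
  intro M hM N hN h
  have key : ∀ {M N : Ideal B}, (p : B) ∈ N →
      Ideal.Quotient.mk (Ideal.span {(p : B)}) '' (M : Set B) =
      Ideal.Quotient.mk (Ideal.span {(p : B)}) '' (N : Set B) → M ≤ N := by
    intro M N hN h x hx
    obtain ⟨y, hy, hyx⟩ := h ▸ Set.mem_image_of_mem _ hx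
    have h2 := (Ideal.span_singleton_le_iff_mem N).2 hN
      ((Ideal.Quotient.mk_eq_mk_iff_sub_mem _ _).1 hyx)
    have h3 := N.sub_mem hy h2
    rwa [sub_sub_cancel] at h3
  exact le_antisymm (key hN.2 h) (key hM.2 h.symm)

variable [IsDomain A] [IsFractionRing A K] [IsDomain B] [IsFractionRing B K]

/-- With y a local generator of I at p, the sublattice ℤy + pI is invertible over A and extends back
to I. -/
theorem extendClass_surjective {p : ℕ}
    (hA : lattice A K = 1 ⊔ span ℤ {(p : K)} * lattice B K)
    (hfin : {M : Ideal B | M.IsMaximal ∧ (p : B) ∈ M}.Finite) :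
    Function.Surjective (extendClass A B K (lattice_le_of_eq hA)) := by
  intro x
  obtain ⟨U, rfl⟩ := cls_surjective B K x
  obtain ⟨y, hy, y', hy', h⟩ := exists_mul_sub_one_mem U.mul_inv p hfin
  have hB := isRingLattice_lattice B K
  have hI := restrictScalars_mul_lattice (U : Submodule B K)
  have hI' := restrictScalars_mul_lattice ((U⁻¹ : (Submodule B K)ˣ) : Submodule B K)
  have hII' : (U : Submodule B K).restrictScalars ℤ *
      ((U⁻¹ : (Submodule B K)ˣ) : Submodule B K).restrictScalars ℤ = lattice B K := by
    rw [← Submodule.restrictScalars_mul, U.mul_inv]; rfl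
  obtain ⟨V, hV⟩ := exists_unit_of_lattice (R := A) (hA ▸ descend_lattice_mul_order hB hI hy)
    (hA ▸ descend_lattice_mul_order hB hI' hy')
    (hA ▸ descend_lattice_mul_inverse hB hI' hII' hy hy' h)
  refine ⟨cls A K V, ?_⟩
  rw [extendClass_cls]
  congr 1
  refine Units.ext (Submodule.restrictScalars_injective ℤ B K ?_)
  rw [Units.coe_map]
  exact (restrictScalars_extendSubmodule _ _).trans
    (hV ▸ descend_lattice_mul hI hII' hy hy' h)

end Surjective

end QuadraticClassGroup

namespace QuadraticClassGroup

/-! ### Change of ℓ-rank under a surjection of finite abelian groups. -/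

section Rank

/-- Trades the dimension for the count |G[ℓ]|, so that ranks can be compared through indices. -/
theorem pow_rk_primaryComponent (ℓ : ℕ) [Fact ℓ.Prime] (G : Type*) [CommGroup G] [Finite G] :
    ℓ ^ rk ℓ (CommGroup.primaryComponent G ℓ) = Nat.card (powMonoidHom ℓ : G →* G).ker := by
  unfold rk
  let := AddSubgroup.torsionBy.zmodModule (A := Additive (CommGroup.primaryComponent G ℓ)) (n := ℓ)
  have h := Module.natCard_eq_pow_finrank (K := ZMod ℓ)
    (V := AddSubgroup.torsionBy (Additive (CommGroup.primaryComponent G ℓ)) (ℓ : ℤ))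
  rw [Nat.card_zmod] at h
  rw [← h]
  refine Nat.card_congr
    { toFun := fun x => ⟨(x.1.toMul : G), ?_⟩
      invFun := fun g => ⟨Additive.ofMul ⟨g.1, ?_⟩, ?_⟩
      left_inv := fun x => rfl
      right_inv := fun x => rfl }
  · have hx := x.2
    change (ℓ : ℤ) • x.1 = 0 at hx
    have h2 : x.1.toMul ^ ℓ = 1 := by
      have h3 := congrArg Additive.toMul hx
      rwa [toMul_zsmul, zpow_natCast] at h3
    rw [MonoidHom.mem_ker, powMonoidHom_apply]
    exact congrArg Subtype.val h2
  · rw [CommGroup.mem_primaryComponent]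
    exact ⟨1, by rw [pow_one]; exact MonoidHom.mem_ker.1 g.2⟩
  · change _ ∈ Submodule.torsionBy ℤ _ _
    rw [Submodule.mem_torsionBy_iff]
    apply Additive.toMul.injective
    apply Subtype.ext
    have h2 : g.1 ^ ℓ = 1 := MonoidHom.mem_ker.1 g.2
    simpa using h2

variable {G G' : Type*} [CommGroup G] [CommGroup G']

theorem card_ker_powMonoidHom [Finite G] (n : ℕ) :
    Nat.card (powMonoidHom n : G →* G).ker = (powMonoidHom n : G →* G).range.index := by
  have h1 := Subgroup.card_mul_index (powMonoidHom n : G →* G).ker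
  have h2 := Subgroup.card_mul_index (powMonoidHom n : G →* G).range
  rw [Subgroup.index_ker] at h1
  have h3 : 0 < Nat.card (powMonoidHom n : G →* G).range := Nat.card_pos
  rw [← h2, mul_comm] at h1
  exact Nat.eq_of_mul_eq_mul_left h3 h1

theorem comap_range_powMonoidHom (φ : G' →* G) (hφ : Function.Surjective φ) (n : ℕ) :
    (powMonoidHom n : G →* G).range.comap φ = (powMonoidHom n : G' →* G').range ⊔ φ.ker := by
  rw [← Subgroup.comap_map_eq]
  congr 1
  ext g
  constructor
  · rintro ⟨h, rfl⟩
    obtain ⟨h', rfl⟩ := hφ h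
    exact ⟨h' ^ n, ⟨h', rfl⟩, by simp⟩
  · rintro ⟨_, ⟨h', rfl⟩, rfl⟩
    exact ⟨φ h', by simp⟩

/-- The preimage of G^n is G'^n · ker φ, so passing to G' multiplies the index by [G'^n ker φ :
G'^n]. -/
theorem index_range_powMonoidHom (φ : G' →* G) (hφ : Function.Surjective φ) (n : ℕ) :
    (powMonoidHom n : G' →* G').range.index =
      (powMonoidHom n : G' →* G').range.relIndex ((powMonoidHom n : G' →* G').range ⊔ φ.ker) *
        (powMonoidHom n : G →* G).range.index := by
  rw [← Subgroup.index_comap_of_surjective _ hφ, comap_range_powMonoidHom φ hφ,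
    Subgroup.relIndex_mul_index le_sup_left]

variable (ℓ : ℕ) [Fact ℓ.Prime]

theorem rk_eq_of_ker_le [Finite G] [Finite G'] (φ : G' →* G) (hφ : Function.Surjective φ)
    (hker : φ.ker ≤ (powMonoidHom ℓ : G' →* G').range) :
    rk ℓ (CommGroup.primaryComponent G' ℓ) = rk ℓ (CommGroup.primaryComponent G ℓ) := by
  apply Nat.pow_right_injective (Fact.out : ℓ.Prime).two_le
  simp only
  rw [pow_rk_primaryComponent, pow_rk_primaryComponent, card_ker_powMonoidHom,
    card_ker_powMonoidHom, index_range_powMonoidHom φ hφ, sup_eq_left.2 hker,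
    Subgroup.relIndex_self, one_mul]

theorem relIndex_range_powMonoidHom_zpowers_le (z : G) :
    (powMonoidHom ℓ : G →* G).range.relIndex (Subgroup.zpowers z) ≤ ℓ := by
  have hℓ : 0 < ℓ := (Fact.out : ℓ.Prime).pos
  rw [Subgroup.relIndex, Subgroup.index]
  have hs : Function.Surjective fun i : Fin ℓ =>
      (QuotientGroup.mk (⟨z ^ (i : ℕ), Subgroup.npow_mem_zpowers z i⟩ : Subgroup.zpowers z) :
        _ ⧸ (powMonoidHom ℓ : G →* G).range.subgroupOf (Subgroup.zpowers z)) := by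
    intro q
    obtain ⟨⟨_, n, rfl⟩, rfl⟩ := QuotientGroup.mk_surjective q
    have hn : 0 ≤ n % ℓ := Int.emod_nonneg _ (by exact_mod_cast hℓ.ne')
    refine ⟨⟨(n % ℓ).toNat, ?_⟩, ?_⟩
    · zify
      rw [Int.toNat_of_nonneg hn]
      exact Int.emod_lt_of_pos _ (by exact_mod_cast hℓ)
    · rw [QuotientGroup.eq, Subgroup.mem_subgroupOf]
      refine ⟨z ^ (n / ℓ), ?_⟩
      simp only [powMonoidHom_apply, Subgroup.coe_mul, Subgroup.coe_inv]
      rw [← zpow_natCast z (n % ℓ).toNat, Int.toNat_of_nonneg hn, ← zpow_natCast, ← zpow_mul,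
        ← zpow_neg, ← zpow_add]
      congr 1
      have := Int.emod_add_mul_ediv n ℓ
      linarith
  simpa using Nat.card_le_card_of_surjective _ hs

/-- The extra factor is [ker φ : ker φ ∩ G'^ℓ], at most ℓ because ker φ sits in a cyclic group. The
two indices are powers of ℓ, so the exponent rises by 0 or 1. -/
theorem rk_eq_or_of_ker_le [Finite G] [Finite G'] (φ : G' →* G) (hφ : Function.Surjective φ)
    (z : G') (hker : φ.ker ≤ Subgroup.zpowers z) :
    rk ℓ (CommGroup.primaryComponent G' ℓ) = rk ℓ (CommGroup.primaryComponent G ℓ) ∨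
      rk ℓ (CommGroup.primaryComponent G' ℓ) = rk ℓ (CommGroup.primaryComponent G ℓ) + 1 := by
  have hℓ : 1 < ℓ := (Fact.out : ℓ.Prime).one_lt
  have h := index_range_powMonoidHom φ hφ ℓ
  rw [← card_ker_powMonoidHom, ← card_ker_powMonoidHom, ← pow_rk_primaryComponent,
    ← pow_rk_primaryComponent, Subgroup.relIndex_sup_left] at h
  have hne : ∀ H L : Subgroup G', H.relIndex L ≠ 0 := fun H L => Subgroup.index_ne_zero_of_finite
  have hle : (powMonoidHom ℓ : G' →* G').range.relIndex φ.ker ≤ ℓ :=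
    (Subgroup.relIndex_le_of_le_right hker (hne _ _)).trans
      (relIndex_range_powMonoidHom_zpowers_le ℓ z)
  have h0 : 0 < (powMonoidHom ℓ : G' →* G').range.relIndex φ.ker :=
    Nat.pos_of_ne_zero (hne _ _)
  have h1 : rk ℓ (CommGroup.primaryComponent G ℓ) ≤ rk ℓ (CommGroup.primaryComponent G' ℓ) := by
    rw [← Nat.pow_le_pow_iff_right hℓ, h]
    exact Nat.le_mul_of_pos_left _ h0
  have h2 : rk ℓ (CommGroup.primaryComponent G' ℓ) ≤ rk ℓ (CommGroup.primaryComponent G ℓ) + 1 := by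
    rw [← Nat.pow_le_pow_iff_right hℓ, h, pow_succ']
    exact Nat.mul_le_mul_right _ hle
  omega

end Rank

end QuadraticClassGroup

namespace QuadraticClassGroup

open Submodule

/-! ### One step A = ℤ + ℓB: powers of 1 + τ and their classes. -/

section Step

section LatticePowers

variable {K : Type*} [Field K] {B : Submodule ℤ K}

theorem one_add_pow_sub_mem (hB : IsRingLattice B) {m : ℕ} {τ : K} (hτ : τ ∈ B)
    (hτ2 : τ * τ ∈ span ℤ {(m : K)} * B) (n : ℕ) :
    (1 + τ) ^ n - (1 + n * τ) ∈ span ℤ {(m : K)} * B := by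
  induction n with
  | zero => simp
  | succ n ih =>
    have h : (1 + τ) ^ (n + 1) - (1 + ((n + 1 : ℕ) : K) * τ) =
        ((1 + τ) ^ n - (1 + n * τ)) * (1 + τ) + τ * τ * n := by push_cast; ring
    rw [h]
    exact add_mem (hB.smul_mem_right ih (add_mem hB.one_mem hτ))
      (hB.smul_mem_right hτ2 (hB.nat_mem n))

/-- Each intermediate binomial term gains one ℓ from the coefficient and another from τ²; only τ^ℓ
needs its own hypothesis. -/
theorem one_add_pow_prime_sub_mem (hB : IsRingLattice B) {ℓ : ℕ} (hℓ : ℓ.Prime) {τ : K}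
    (hτ : τ ∈ B) (hτ2 : τ * τ ∈ span ℤ {(ℓ : K)} * B)
    (hτℓ : τ ^ ℓ ∈ span ℤ {((ℓ ^ 2 : ℕ) : K)} * B) :
    (1 + τ) ^ ℓ - (1 + ℓ * τ) ∈ span ℤ {((ℓ ^ 2 : ℕ) : K)} * B := by
  obtain ⟨n, rfl⟩ := Nat.exists_eq_add_of_le' hℓ.two_le
  obtain ⟨b, hb, hb'⟩ := mem_span_mul.1 hτ2
  have h : (1 + τ) ^ (n + 2) - (1 + ((n + 2 : ℕ) : K) * τ) =
      ∑ i ∈ Finset.range n, τ ^ (i + 2) * ((n + 2).choose (i + 2) : K) + τ ^ (n + 2) := by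
    rw [add_comm 1 τ, add_pow, Finset.sum_range_succ, Finset.sum_range_succ',
      Finset.sum_range_succ']
    simp
    ring
  rw [h]
  refine add_mem (sum_mem fun i hi => ?_) hτℓ
  obtain ⟨c, hc⟩ := hℓ.dvd_choose_self (k := i + 2) (by lia) (by simpa using hi)
  refine mem_span_mul.2 ⟨b * τ ^ i * c, hB.mul_mem (hB.mul_mem hb (hB.pow_mem hτ i))
    (hB.nat_mem c), ?_⟩
  rw [hc, pow_add, pow_two τ, hb']
  push_cast
  ring

theorem isUnitMod_one_add (hB : IsRingLattice B) {m : ℕ} {τ : K} (hτ : τ ∈ B)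
    (hτ2 : τ * τ ∈ span ℤ {(m : K)} * B) : IsUnitMod B m (1 + τ) := by
  refine ⟨add_mem hB.one_mem hτ, 1 - τ, sub_mem hB.one_mem hτ, ?_⟩
  have h : (1 + τ) * (1 - τ) - 1 = -(τ * τ) := by ring
  rw [h]
  exact neg_mem hτ2

/-- The inverse is a truncated geometric series: (1 + τ)(1 - τ)(1 + τ²) = 1 - τ⁴ and τ⁴ ∈ m²B. -/
theorem isUnitMod_sq_one_add (hB : IsRingLattice B) {m : ℕ} {τ : K} (hτ : τ ∈ B)
    (hτ2 : τ * τ ∈ span ℤ {(m : K)} * B) : IsUnitMod B (m ^ 2) (1 + τ) := by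
  obtain ⟨b, hb, hb'⟩ := mem_span_mul.1 hτ2
  refine ⟨add_mem hB.one_mem hτ, (1 - τ) * (1 + τ * τ), hB.mul_mem (sub_mem hB.one_mem hτ)
    (add_mem hB.one_mem (hB.mul_mem hτ hτ)), mem_span_mul.2 ⟨-(b * b),
      neg_mem (hB.mul_mem hb hb), ?_⟩⟩
  push_cast
  linear_combination (-(τ * τ) - m * b) * hb'

theorem exists_int_mul_sub_one {ℓ : ℕ} (hℓ : ℓ.Prime) {a : ℤ} (ha : ¬ (ℓ : ℤ) ∣ a) :
    ∃ a' k : ℤ, a' * a - 1 = ℓ * k := by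
  obtain ⟨k, m, hkm⟩ : IsCoprime (ℓ : ℤ) a :=
    (Nat.prime_iff_prime_int.1 hℓ).irreducible.coprime_iff_not_dvd.2 ha
  exact ⟨m, -k, by linarith⟩

/-- Modulo ℓB, u = a + bτ with τ² = 0. Scaling by an inverse a' of a gives 1 + kτ ≡ (1 + τ)^k with k
≡ a'b mod ℓ. -/
theorem exists_unitLattice_eq_one_add (hB : IsRingLattice B) {ℓ : ℕ} (hℓ : ℓ.Prime)
    (h1 : (1 : K) ∉ span ℤ {(ℓ : K)} * B) {τ : K} (hτ : τ ∈ B)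
    (hgen : B ≤ 1 ⊔ (span ℤ {τ} ⊔ span ℤ {(ℓ : K)} * B))
    (hτ2 : τ * τ ∈ span ℤ {(ℓ : K)} * B) {u : K} (hu : IsUnitMod B ℓ u) :
    ∃ k : ℕ, unitLattice B ℓ u = unitLattice B ℓ ((1 + τ) ^ k) := by
  obtain ⟨hu, v, hv, huv⟩ := hu
  obtain ⟨a, ha⟩ := mem_one_sup.1 (hgen hu)
  obtain ⟨b, hb⟩ := mem_span_sup.1 ha
  -- If ℓ ∣ a then u ≡ bτ has square in ℓB, which is impossible for a unit modulo ℓ.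
  have haℓ : ¬ (ℓ : ℤ) ∣ a := by
    rintro ⟨a', rfl⟩
    have h2 : u - b * τ ∈ span ℤ {(ℓ : K)} * B := by
      have : u - b * τ = u - ((ℓ * a' : ℤ) : K) - b * τ + ℓ * a' := by push_cast; ring
      rw [this]
      exact add_mem hb (mem_span_mul.2 ⟨a', hB.int_mem a', rfl⟩)
    have h3 : u * u ∈ span ℤ {(ℓ : K)} * B := by
      have : u * u = (u - b * τ) * (u + b * τ) + τ * τ * (b * b) := by ring
      rw [this]
      exact add_mem (hB.smul_mem_right h2 (add_mem hu (hB.mul_mem (hB.int_mem b) hτ)))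
        (hB.smul_mem_right hτ2 (hB.mul_mem (hB.int_mem b) (hB.int_mem b)))
    apply h1
    have : (1 : K) = u * u * (v * v) - (u * v - 1) * (u * v + 1) := by ring
    rw [this]
    exact sub_mem (hB.smul_mem_right h3 (hB.mul_mem hv hv))
      (hB.smul_mem_right huv (add_mem (hB.mul_mem hu hv) hB.one_mem))
  obtain ⟨a', e, he⟩ := exists_int_mul_sub_one hℓ haℓ
  have he' : (a' : K) * a - 1 = ℓ * e := by simpa using congrArg (Int.cast : ℤ → K) he
  have hℓ0 : (ℓ : ℤ) ≠ 0 := by exact_mod_cast hℓ.ne_zero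
  have hk := Int.toNat_of_nonneg (Int.emod_nonneg (a' * b) hℓ0)
  have hk2 := Int.emod_add_mul_ediv (a' * b) ℓ
  set k := ((a' * b) % ℓ).toNat with hkdef
  set q := (a' * b) / ℓ
  have hkK : (k : K) = a' * b - ℓ * q := by
    have : (k : ℤ) = a' * b - ℓ * q := by rw [hk]; linarith
    simpa using congrArg (Int.cast : ℤ → K) this
  have hmem : ∀ n : ℤ, ∀ x ∈ B, (ℓ : K) * n * x ∈ span ℤ {(ℓ : K)} * B := fun n x hx =>
    mem_span_mul.2 ⟨n * x, hB.mul_mem (hB.int_mem n) hx, by ring⟩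
  refine ⟨k, Eq.trans ?_ (unitLattice_eq_of_sub_mem (one_add_pow_sub_mem hB hτ hτ2 k)).symm⟩
  refine unitLattice_congr a a' ?_ ?_
  · have : u - a * (1 + k * τ) = (u - a - b * τ) - ℓ * e * (b * τ) + ℓ * q * (a * τ) := by
      rw [hkK]; linear_combination -(b * τ) * he'
    rw [this]
    exact add_mem (sub_mem hb (hmem _ _ (hB.mul_mem (hB.int_mem b) hτ)))
      (hmem _ _ (hB.mul_mem (hB.int_mem a) hτ))
  · have : 1 + k * τ - a' * u = -(a' * (u - a - b * τ)) - ℓ * e * 1 - ℓ * q * τ := by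
      rw [hkK]; linear_combination -he'
    rw [this]
    exact sub_mem (sub_mem (neg_mem (hB.smul_mem_left hb (hB.int_mem a')))
      (hmem _ _ hB.one_mem)) (hmem _ _ hτ)

end LatticePowers

variable {A B C K : Type*} [Field K] [CommRing A] [Algebra A K] [CommRing B] [Algebra B K]
  [CommRing C] [Algebra C K]
  [IsDomain A] [IsFractionRing A K] [IsDomain B] [IsFractionRing B K]
  {ℓ : ℕ} [Fact ℓ.Prime]

theorem ker_extendClass_le_zpowers (hA : lattice A K = 1 ⊔ span ℤ {(ℓ : K)} * lattice B K)
    (h1 : (1 : K) ∉ span ℤ {(ℓ : K)} * lattice B K)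
    {τ : K} (hτ : τ ∈ lattice B K)
    (hgen : lattice B K ≤ 1 ⊔ (span ℤ {τ} ⊔ span ℤ {(ℓ : K)} * lattice B K))
    (hτ2 : τ * τ ∈ span ℤ {(ℓ : K)} * lattice B K) :
    (extendClass A B K (lattice_le_of_eq hA)).ker ≤
      Subgroup.zpowers (latticeClass A (unitLattice (lattice B K) ℓ (1 + τ))) := by
  intro x hx
  have hB := isRingLattice_lattice B K
  obtain ⟨u, hu, rfl⟩ := exists_of_extendClass_eq_one Fact.out hA h1 (MonoidHom.mem_ker.1 hx)
  obtain ⟨k, hk⟩ := exists_unitLattice_eq_one_add hB Fact.out h1 hτ hgen hτ2 hu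
  rw [hk, latticeClass_unitLattice_pow hB hA (isUnitMod_one_add hB hτ hτ2)]
  exact Subgroup.npow_mem_zpowers _ _

theorem rk_step_eq_or [Finite (ClassGroup A)] [Finite (ClassGroup B)]
    (hA : lattice A K = 1 ⊔ span ℤ {(ℓ : K)} * lattice B K)
    (h1 : (1 : K) ∉ span ℤ {(ℓ : K)} * lattice B K)
    (hfin : {M : Ideal B | M.IsMaximal ∧ (ℓ : B) ∈ M}.Finite)
    {τ : K} (hτ : τ ∈ lattice B K)
    (hgen : lattice B K ≤ 1 ⊔ (span ℤ {τ} ⊔ span ℤ {(ℓ : K)} * lattice B K))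
    (hτ2 : τ * τ ∈ span ℤ {(ℓ : K)} * lattice B K) :
    rk ℓ (CommGroup.primaryComponent (ClassGroup A) ℓ) =
        rk ℓ (CommGroup.primaryComponent (ClassGroup B) ℓ) ∨
      rk ℓ (CommGroup.primaryComponent (ClassGroup A) ℓ) =
        rk ℓ (CommGroup.primaryComponent (ClassGroup B) ℓ) + 1 :=
  rk_eq_or_of_ker_le ℓ _ (extendClass_surjective hA hfin) _
    (ker_extendClass_le_zpowers hA h1 hτ hgen hτ2)

/-- The class of u equals that of u^(ℓ²), hence is the ℓ-th power of an ℓ-th power. -/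
theorem rk_step_eq_of_pow_sub_mem [Finite (ClassGroup A)] [Finite (ClassGroup B)]
    (hA : lattice A K = 1 ⊔ span ℤ {(ℓ : K)} * lattice B K)
    (h1 : (1 : K) ∉ span ℤ {(ℓ : K)} * lattice B K)
    (hfin : {M : Ideal B | M.IsMaximal ∧ (ℓ : B) ∈ M}.Finite)
    (hpow : ∀ u ∈ lattice B K, u ^ ℓ ^ 2 - u ∈ span ℤ {(ℓ : K)} * lattice B K) :
    rk ℓ (CommGroup.primaryComponent (ClassGroup A) ℓ) =
      rk ℓ (CommGroup.primaryComponent (ClassGroup B) ℓ) := by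
  refine rk_eq_of_ker_le ℓ _ (extendClass_surjective hA hfin) fun x hx => ?_
  have hB := isRingLattice_lattice B K
  obtain ⟨u, hu, rfl⟩ := exists_of_extendClass_eq_one Fact.out hA h1 (MonoidHom.mem_ker.1 hx)
  refine ⟨latticeClass A (unitLattice (lattice B K) ℓ u) ^ ℓ, ?_⟩
  rw [powMonoidHom_apply, ← pow_mul, ← pow_two, ← latticeClass_unitLattice_pow hB hA hu,
    unitLattice_eq_of_sub_mem (hpow u hu.1)]

/-- Lets one lattice be read over two moduli. The right side has in addition only the integer
multiples of m, and m ≡ m(1 + kmτ) mod m²Λ. -/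
theorem unitLattice_sq_eq {Λ : Submodule ℤ K} (hΛ : IsRingLattice Λ) {m : ℕ} {τ : K} (hτ : τ ∈ Λ)
    (k : ℕ) :
    unitLattice Λ (m ^ 2) (1 + k * (m * τ)) =
      unitLattice (1 ⊔ span ℤ {(m : K)} * Λ) m (1 + k * (m * τ)) := by
  refine le_antisymm (sup_le_sup_left ?_ _) (sup_le le_sup_left ?_)
  · intro x hx
    obtain ⟨y, hy, rfl⟩ := mem_span_mul.1 hx
    exact mem_span_mul.2 ⟨m * y, mem_sup_right (mem_span_mul.2 ⟨y, hy, rfl⟩), by push_cast; ring⟩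
  · intro x hx
    obtain ⟨y, hy, rfl⟩ := mem_span_mul.1 hx
    obtain ⟨n, hn⟩ := mem_one_sup.1 hy
    obtain ⟨z, hz, hz'⟩ := mem_span_mul.1 hn
    refine mem_span_sup.2 ⟨n * m, mem_span_mul.2 ⟨z - n * (k * τ), sub_mem hz
      (hΛ.mul_mem (hΛ.int_mem n) (hΛ.mul_mem (hΛ.nat_mem k) hτ)), ?_⟩⟩
    push_cast
    linear_combination (m : K) * hz'

/-- The kernel lies in the group generated by the class z of 1 + ℓτ. Viewing A as ℤ + ℓ²C, `hpow`
says that z^k is the ℓ-th power of the class of 1 + τ; as ℓ ∤ k, z is itself an ℓ-th power. -/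
theorem rk_step_eq_of_pow_eq [Finite (ClassGroup A)] [Finite (ClassGroup B)]
    (hA : lattice A K = 1 ⊔ span ℤ {(ℓ : K)} * lattice B K)
    (hBC : lattice B K = 1 ⊔ span ℤ {(ℓ : K)} * lattice C K)
    (h1 : (1 : K) ∉ span ℤ {(ℓ : K)} * lattice B K)
    (hfin : {M : Ideal B | M.IsMaximal ∧ (ℓ : B) ∈ M}.Finite)
    {τ : K} (hτ : τ ∈ lattice C K)
    (hgen : lattice C K ≤ 1 ⊔ (span ℤ {τ} ⊔ span ℤ {(ℓ : K)} * lattice C K))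
    (hτ2 : τ * τ ∈ span ℤ {(ℓ : K)} * lattice C K)
    {k : ℕ} (hk : ¬ ℓ ∣ k)
    (hpow : (1 + τ) ^ ℓ - (1 + k * (ℓ * τ)) ∈ span ℤ {((ℓ ^ 2 : ℕ) : K)} * lattice C K) :
    rk ℓ (CommGroup.primaryComponent (ClassGroup A) ℓ) =
      rk ℓ (CommGroup.primaryComponent (ClassGroup B) ℓ) := by
  have hℓ : ℓ.Prime := Fact.out
  have hB := isRingLattice_lattice B K
  have hC := isRingLattice_lattice C K
  have hle : span ℤ {(ℓ : K)} * lattice C K ≤ lattice B K := hBC ▸ le_sup_right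
  have hσ : (ℓ : K) * τ ∈ lattice B K := hle (mem_span_mul.2 ⟨τ, hτ, rfl⟩)
  have hσ2 : (ℓ * τ) * (ℓ * τ) ∈ span ℤ {(ℓ : K)} * lattice B K :=
    mem_span_mul.2 ⟨ℓ * (τ * τ), hle (mem_span_mul.2 ⟨_, hC.mul_mem hτ hτ, rfl⟩), by ring⟩
  have hσgen : lattice B K ≤ 1 ⊔ (span ℤ {ℓ * τ} ⊔ span ℤ {(ℓ : K)} * lattice B K) := by
    intro x hx
    rw [hBC] at hx
    obtain ⟨n, hn⟩ := mem_one_sup.1 hx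
    obtain ⟨y, hy, hy'⟩ := mem_span_mul.1 hn
    obtain ⟨a, ha⟩ := mem_one_sup.1 (hgen hy)
    obtain ⟨b, hb⟩ := mem_span_sup.1 ha
    refine mem_one_sup.2 ⟨n + ℓ * a, mem_span_sup.2 ⟨b, mem_span_mul.2 ⟨_, hle hb, ?_⟩⟩⟩
    push_cast
    linear_combination hy'
  have hA2 : lattice A K = 1 ⊔ span ℤ {((ℓ ^ 2 : ℕ) : K)} * lattice C K := by
    have hsq : span ℤ {((ℓ ^ 2 : ℕ) : K)} = span ℤ {(ℓ : K)} * span ℤ {(ℓ : K)} := by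
      rw [span_mul_span, Set.singleton_mul_singleton]; push_cast; rw [pow_two]
    have hle1 : span ℤ {(ℓ : K)} ≤ 1 := by
      rw [span_singleton_le_iff_mem]
      exact Submodule.mem_one.2 ⟨ℓ, by simp⟩
    rw [hA, hBC, Submodule.mul_sup, mul_one, ← sup_assoc, sup_eq_left.2 hle1, hsq, mul_assoc]
  set z := latticeClass A (unitLattice (lattice B K) ℓ (1 + ℓ * τ)) with hz
  have hzk : z ^ k = latticeClass A (unitLattice (lattice C K) (ℓ ^ 2) (1 + τ)) ^ ℓ := by
    rw [hz, ← latticeClass_unitLattice_pow hB hA (isUnitMod_one_add hB hσ hσ2),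
      ← latticeClass_unitLattice_pow hC hA2 (isUnitMod_sq_one_add hC hτ hτ2),
      unitLattice_eq_of_sub_mem (one_add_pow_sub_mem hB hσ hσ2 k),
      unitLattice_eq_of_sub_mem hpow, unitLattice_sq_eq hC hτ, ← hBC]
  have hmem : z ∈ (powMonoidHom ℓ : ClassGroup A →* ClassGroup A).range := by
    obtain ⟨a, b, hab⟩ := Nat.isCoprime_iff_coprime.2 ((hℓ.coprime_iff_not_dvd).2 hk)
    have h2 : z = (z ^ a) ^ ℓ * (z ^ k) ^ b := by
      rw [← zpow_natCast, ← zpow_natCast, ← zpow_mul, ← zpow_mul, ← zpow_add, mul_comm (k : ℤ) b,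
        hab, zpow_one]
    rw [h2, hzk]
    exact mul_mem ⟨z ^ a, rfl⟩ (zpow_mem (MonoidHom.mem_range.2 ⟨_, rfl⟩) b)
  exact rk_eq_of_ker_le ℓ _ (extendClass_surjective hA hfin)
    ((ker_extendClass_le_zpowers hA h1 hσ hσgen hσ2).trans ((Subgroup.zpowers_le).2 hmem))

/-- Residues modulo ℓB already give all kernel classes, so the kernel is finite. -/
theorem finite_classGroup_step (hA : lattice A K = 1 ⊔ span ℤ {(ℓ : K)} * lattice B K)
    (h1 : (1 : K) ∉ span ℤ {(ℓ : K)} * lattice B K) [Finite (B ⧸ Ideal.span {(ℓ : B)})]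
    [Finite (ClassGroup B)] : Finite (ClassGroup A) := by
  have hker : Finite (extendClass A B K (lattice_le_of_eq hA)).ker := by
    have hsub : ((extendClass A B K (lattice_le_of_eq hA)).ker : Set (ClassGroup A)) ⊆
        Set.range fun q : B ⧸ Ideal.span {(ℓ : B)} =>
          latticeClass A (unitLattice (lattice B K) ℓ (algebraMap B K (Quotient.out q))) := by
      intro x hx
      obtain ⟨u, hu, rfl⟩ := exists_of_extendClass_eq_one Fact.out hA h1 (MonoidHom.mem_ker.1 hx)
      obtain ⟨b, rfl⟩ := mem_lattice.1 hu.1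
      refine ⟨Ideal.Quotient.mk _ b, congrArg _ (unitLattice_eq_of_sub_mem ?_)⟩
      have h2 : Ideal.Quotient.mk (Ideal.span {(ℓ : B)})
          (Quotient.out (Ideal.Quotient.mk (Ideal.span {(ℓ : B)}) b)) =
          Ideal.Quotient.mk (Ideal.span {(ℓ : B)}) b := Quotient.out_eq _
      obtain ⟨c, hc⟩ := Ideal.mem_span_singleton.1 ((Ideal.Quotient.mk_eq_mk_iff_sub_mem _ _).1 h2)
      refine mem_span_mul.2 ⟨algebraMap B K c, mem_lattice.2 ⟨c, rfl⟩, ?_⟩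
      rw [← map_sub, hc, map_mul, map_natCast]
    exact ((Set.finite_range _).subset hsub).to_subtype
  refine Nat.finite_of_card_ne_zero ?_
  rw [← Subgroup.card_mul_index (extendClass A B K (lattice_le_of_eq hA)).ker, Subgroup.index_ker]
  exact mul_ne_zero Nat.card_pos.ne' Nat.card_pos.ne'

end Step

end QuadraticClassGroup

namespace QuadraticClassGroup

open Submodule NumberField

/-! ### The orders ℤ + m𝓞_K as lattices; finiteness of their class groups. -/

section Orders

variable {K : Type*} [Field K]

theorem algebraMap_order_apply {m : ℕ} (x : order K m) :
    algebraMap (order K m) K x = algebraMap (𝓞 K) K x.1 := rfl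

theorem lattice_order (m : ℕ) :
    lattice (order K m) K = 1 ⊔ span ℤ {(m : K)} * lattice (𝓞 K) K := by
  ext x
  rw [mem_lattice, mem_one_sup]
  constructor
  · rintro ⟨⟨_, a, y, rfl⟩, rfl⟩
    refine ⟨a, mem_span_mul.2 ⟨y, mem_lattice.2 ⟨y, rfl⟩, ?_⟩⟩
    rw [algebraMap_order_apply]
    simp
  · rintro ⟨a, ha⟩
    obtain ⟨_, hy, h⟩ := mem_span_mul.1 ha
    obtain ⟨y, rfl⟩ := mem_lattice.1 hy
    refine ⟨⟨(a : 𝓞 K) + (m : 𝓞 K) * y, a, y, rfl⟩, ?_⟩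
    rw [algebraMap_order_apply, eq_add_of_sub_eq h]
    simp
    ring

theorem lattice_order_mul (p m : ℕ) :
    lattice (order K (p * m)) K = 1 ⊔ span ℤ {(p : K)} * lattice (order K m) K := by
  have hle1 : span ℤ {(p : K)} ≤ 1 := by
    rw [span_singleton_le_iff_mem]
    exact Submodule.mem_one.2 ⟨p, by simp⟩
  rw [lattice_order, lattice_order, Submodule.mul_sup, mul_one, ← sup_assoc, sup_eq_left.2 hle1,
    ← mul_assoc, span_mul_span, Set.singleton_mul_singleton, Nat.cast_mul]

theorem lattice_order_le (m : ℕ) : lattice (order K m) K ≤ lattice (𝓞 K) K :=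
  lattice_le_of_eq (lattice_order m)

theorem span_mul_lattice_le_order (m : ℕ) :
    span ℤ {(m : K)} * lattice (𝓞 K) K ≤ lattice (order K m) K :=
  lattice_order (K := K) m ▸ le_sup_right

theorem mem_span_natCast_iff (n : ℕ) (x : 𝓞 K) :
    x ∈ Ideal.span {(n : 𝓞 K)} ↔
      algebraMap (𝓞 K) K x ∈ span ℤ {(n : K)} * lattice (𝓞 K) K := by
  rw [Ideal.mem_span_singleton, mem_span_mul]
  constructor
  · rintro ⟨y, rfl⟩
    exact ⟨_, mem_lattice.2 ⟨y, rfl⟩, by simp⟩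
  · rintro ⟨_, hy, h⟩
    obtain ⟨y, rfl⟩ := mem_lattice.1 hy
    exact ⟨y, RingOfIntegers.coe_injective (by simpa using h)⟩

variable [NumberField K]

instance isFractionRing_order (m : ℕ) [NeZero m] : IsFractionRing (order K m) K := by
  have : FaithfulSMul (order K m) K := by
    rw [faithfulSMul_iff_algebraMap_injective]
    intro x y h
    exact Subtype.ext (FaithfulSMul.algebraMap_injective (𝓞 K) K h)
  refine IsFractionRing.of_field _ _ fun z => ?_
  obtain ⟨x, y, -, rfl⟩ := IsFractionRing.div_surjective (𝓞 K) z
  refine ⟨⟨m * x, 0, x, by simp⟩, ⟨m * y, 0, y, by simp⟩, ?_⟩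
  rw [algebraMap_order_apply, algebraMap_order_apply]
  rw [map_mul, map_mul, map_natCast]
  exact (mul_div_mul_left _ _ (NeZero.ne _)).symm

theorem one_notMem_span_mul_ringOfIntegers {p : ℕ} (hp : p.Prime) :
    (1 : K) ∉ span ℤ {(p : K)} * lattice (𝓞 K) K := by
  intro h
  obtain ⟨_, hy, h⟩ := mem_span_mul.1 h
  obtain ⟨y, rfl⟩ := mem_lattice.1 hy
  have h2 : (1 : 𝓞 K) = p * y := RingOfIntegers.coe_injective (by simpa using h)
  have h3 : IsUnit ((p : ℕ) : 𝓞 K) := IsUnit.of_mul_eq_one y h2.symm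
  have h4 := h3.map (Algebra.norm ℤ)
  rw [Algebra.norm_natCast, isUnit_pow_iff (Module.finrank_pos).ne'] at h4
  exact (Nat.prime_iff_prime_int.1 hp).not_isUnit h4

theorem one_notMem_span_mul_order {p : ℕ} (hp : p.Prime) (m : ℕ) :
    (1 : K) ∉ span ℤ {(p : K)} * lattice (order K m) K := fun h =>
  one_notMem_span_mul_ringOfIntegers hp (mul_le_mul_right (lattice_order_le m) _ h)

theorem finite_quotient_order (m : ℕ) {p : ℕ} (hp : p ≠ 0) :
    Finite (order K m ⧸ Ideal.span {(p : order K m)}) := by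
  have : Module.Finite ℤ (order K m) :=
    Module.Finite.of_injective (order K m).val.toLinearMap Subtype.val_injective
  have : Module.IsTorsionFree ℤ (order K m) :=
    Function.Injective.moduleIsTorsionFree (order K m).val.toLinearMap Subtype.val_injective
      (fun n x => map_smul _ n x)
  have : Module.Free ℤ (order K m) := inferInstance
  refine Ideal.finiteQuotientOfFreeOfNeBot _ ?_
  rw [Ne, Ideal.span_singleton_eq_bot]
  exact_mod_cast hp

/-- Prime factors are added to the conductor one at a time, starting from Cl(𝓞_K). -/
theorem finite_classGroup_order (m : ℕ) (hm : m ≠ 0) : Finite (ClassGroup (order K m)) := by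
  induction m using induction_on_primes with
  | zero => exact absurd rfl hm
  | one =>
    have h : order K 1 = ⊤ := by
      rw [eq_top_iff]
      exact fun x _ => ⟨0, x, by simp⟩
    have key : ∀ S : Subalgebra ℤ (𝓞 K), S = ⊤ → Finite (ClassGroup S) := by
      rintro _ rfl
      exact Finite.of_equiv _ (ClassGroup.mulEquiv
        (Subalgebra.topEquiv (R := ℤ) (A := 𝓞 K)).toRingEquiv.symm).toEquiv
    exact key _ h
  | prime_mul p a hp ih =>
    have ha : a ≠ 0 := right_ne_zero_of_mul hm
    have := ih ha
    have : Fact p.Prime := ⟨hp⟩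
    have : NeZero a := ⟨ha⟩
    have : NeZero (p * a) := ⟨hm⟩
    have := finite_quotient_order (K := K) a hp.ne_zero
    exact finite_classGroup_step (K := K) (lattice_order_mul p a) (one_notMem_span_mul_order hp a)

end Orders

/-! ### Arithmetic of ℓ in the quadratic field. -/

section Quadratic

variable {K : Type*} [Field K] [NumberField K]

theorem span_natCast_ne_bot {n : ℕ} (hn : n ≠ 0) : Ideal.span {(n : 𝓞 K)} ≠ ⊥ := by
  rw [Ne, Ideal.span_singleton_eq_bot]
  exact_mod_cast hn

theorem pow_absNorm_sub_mem (P : Ideal (𝓞 K)) [hP : P.IsPrime] (h0 : P ≠ ⊥) (u : 𝓞 K) :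
    u ^ Ideal.absNorm P - u ∈ P := by
  have : P.IsMaximal := hP.isMaximal h0
  let := Ideal.Quotient.field P
  have : Finite (𝓞 K ⧸ P) := Ideal.finiteQuotientOfFreeOfNeBot P h0
  have := Fintype.ofFinite (𝓞 K ⧸ P)
  rw [← Ideal.Quotient.eq, map_pow, Ideal.absNorm_apply, Submodule.cardQuot_apply,
    Nat.card_eq_fintype_card]
  exact FiniteField.pow_card _

variable [Algebra.IsQuadraticExtension ℚ K]

theorem finrank_ringOfIntegers : Module.finrank ℤ (𝓞 K) = 2 := by
  rw [RingOfIntegers.rank, Algebra.IsQuadraticExtension.finrank_eq_two]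

theorem pow_sq_sub_mem_of_isInert {ℓ : ℕ} (hℓ : ℓ.Prime) (h : IsInert K ℓ) (u : 𝓞 K) :
    u ^ ℓ ^ 2 - u ∈ Ideal.span {(ℓ : 𝓞 K)} := by
  have : (Ideal.span {(ℓ : 𝓞 K)}).IsPrime := h
  have h2 := pow_absNorm_sub_mem _ (span_natCast_ne_bot hℓ.ne_zero) u
  rwa [Ideal.absNorm_span_natCast, finrank_ringOfIntegers] at h2

/-- By norms both residue fields have ℓ elements, so u^ℓ ≡ u modulo each prime; applying this twice
gives u^(ℓ²) ≡ u. -/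
theorem pow_sq_sub_mem_of_isSplit {ℓ : ℕ} (hℓ : ℓ.Prime) (h : IsSplit K ℓ) (u : 𝓞 K) :
    u ^ ℓ ^ 2 - u ∈ Ideal.span {(ℓ : 𝓞 K)} := by
  obtain ⟨P, Q, hP, hQ, hPQ, h⟩ := h
  have hne := span_natCast_ne_bot (K := K) hℓ.ne_zero
  have hP0 : P ≠ ⊥ := by rintro rfl; exact hne (by rw [h, Ideal.bot_mul])
  have hQ0 : Q ≠ ⊥ := by rintro rfl; exact hne (by rw [h, Ideal.mul_bot])
  have hnorm := congrArg Ideal.absNorm h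
  rw [map_mul, Ideal.absNorm_span_natCast, finrank_ringOfIntegers] at hnorm
  have hP1 : Ideal.absNorm P ≠ 1 := fun h => hP.ne_top (Ideal.absNorm_eq_one_iff.1 h)
  have hQ1 : Ideal.absNorm Q ≠ 1 := fun h => hQ.ne_top (Ideal.absNorm_eq_one_iff.1 h)
  obtain ⟨hP2, hQ2⟩ := (hℓ.mul_eq_prime_sq_iff hP1 hQ1).1 hnorm.symm
  have key : ∀ R : Ideal (𝓞 K), R.IsPrime → R ≠ ⊥ → Ideal.absNorm R = ℓ → u ^ ℓ ^ 2 - u ∈ R := by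
    intro R hR hR0 hR2
    have h1 := pow_absNorm_sub_mem R hR0 u
    have h2 := pow_absNorm_sub_mem R hR0 (u ^ ℓ)
    rw [hR2] at h1 h2
    have := R.add_mem h2 h1
    rwa [← pow_mul, ← pow_two, sub_add_sub_cancel] at this
  have hmax : IsCoprime P Q := Ideal.isCoprime_iff_sup_eq.2
    (Ideal.IsMaximal.coprime_of_ne (hP.isMaximal hP0) (hQ.isMaximal hQ0) hPQ)
  rw [h, Ideal.mul_eq_inf_of_isCoprime hmax]
  exact ⟨key P hP hP0 hP2, key Q hQ hQ0 hQ2⟩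

/-- The coordinates (p, q) of 1 are coprime, since no prime is invertible in 𝓞_K; hence 1 extends to
a ℤ-basis. -/
theorem exists_generator (K : Type*) [Field K] [NumberField K] [Algebra.IsQuadraticExtension ℚ K] :
    ∃ ω : 𝓞 K, ∀ x : 𝓞 K, ∃ a b : ℤ, x = a + b * ω := by
  let b := Module.finBasisOfFinrankEq ℤ (𝓞 K) finrank_ringOfIntegers
  obtain ⟨p, q, h1⟩ : ∃ p q : ℤ, (1 : 𝓞 K) = p * b 0 + q * b 1 := by
    have := b.sum_repr (1 : 𝓞 K)
    rw [Fin.sum_univ_two] at this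
    exact ⟨b.repr 1 0, b.repr 1 1, by rw [← zsmul_eq_mul, ← zsmul_eq_mul, this]⟩
  have hcop : IsCoprime p q := by
    rw [Int.isCoprime_iff_gcd_eq_one]
    by_contra hne
    obtain ⟨r, hr, hrd⟩ := Nat.exists_prime_and_dvd hne
    have hr2 : (r : ℤ) ∣ (Int.gcd p q : ℤ) := by exact_mod_cast hrd
    obtain ⟨p', hp'⟩ := hr2.trans (Int.gcd_dvd_left p q)
    obtain ⟨q', hq'⟩ := hr2.trans (Int.gcd_dvd_right p q)
    apply one_notMem_span_mul_ringOfIntegers (K := K) hr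
    have := (mem_span_natCast_iff r (1 : 𝓞 K)).1 (Ideal.mem_span_singleton.2
      ⟨p' * b 0 + q' * b 1, by rw [h1, hp', hq']; push_cast; ring⟩)
    rwa [map_one] at this
  obtain ⟨u, v, huv⟩ := hcop
  have huv' : (u : 𝓞 K) * p + v * q = 1 := by exact_mod_cast congrArg (Int.cast : ℤ → 𝓞 K) huv
  -- The matrix with rows (p, q) and (-v, u) has determinant up + vq = 1.
  refine ⟨-v * b 0 + u * b 1, fun x => ?_⟩
  have hx := b.sum_repr x
  rw [Fin.sum_univ_two] at hx
  refine ⟨b.repr x 0 * u + b.repr x 1 * v, -(b.repr x 0) * q + b.repr x 1 * p, ?_⟩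
  nth_rewrite 1 [← hx]
  rw [zsmul_eq_mul, zsmul_eq_mul]
  push_cast
  linear_combination (-(b.repr x 0 : 𝓞 K) * b 0 - b.repr x 1 * b 1) * huv' +
    (b.repr x 0 * u + b.repr x 1 * v : 𝓞 K) * (-h1)

/-- The discriminant in terms of the minimal equation of a generator. -/
theorem exists_sq_eq_discr (K : Type*) [Field K] [NumberField K]
    [Algebra.IsQuadraticExtension ℚ K] :
    ∃ (ω : 𝓞 K) (t : ℤ), (∀ x : 𝓞 K, ∃ a b : ℤ, x = a + b * ω) ∧
      (2 * ω - t) ^ 2 = (discr K : 𝓞 K) := by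
  obtain ⟨ω, hω⟩ := exists_generator K
  obtain ⟨n, t, hnt⟩ := hω (ω ^ 2)
  refine ⟨ω, t, hω, ?_⟩
  have hspan : (⊤ : Submodule ℤ (𝓞 K)) ≤ span ℤ (Set.range ![(1 : 𝓞 K), ω]) := by
    intro x _
    obtain ⟨a, b, rfl⟩ := hω x
    rw [Matrix.range_cons_cons_empty, mem_span_pair]
    exact ⟨a, b, by simp⟩
  let B := basisOfTopLeSpanOfCardEqFinrank ![(1 : 𝓞 K), ω] hspan
    (by rw [finrank_ringOfIntegers, Fintype.card_fin])
  have hB0 : B 0 = 1 := by simp [B]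
  have hB1 : B 1 = ω := by simp [B]
  have htr1 : Algebra.trace ℤ (𝓞 K) 1 = 2 := by
    have := Algebra.trace_algebraMap (R := ℤ) (S := 𝓞 K) 1
    rw [map_one, finrank_ringOfIntegers] at this
    simpa using this
  have hr0 : B.repr (ω * B 0) = B.repr (B 1) := by rw [hB0, hB1, mul_one]
  have hr1 : B.repr (ω * B 1) = B.repr (n • B 0 + t • B 1) := by
    rw [hB0, hB1, ← pow_two, hnt]; simp
  have htr2 : Algebra.trace ℤ (𝓞 K) ω = t := by
    rw [Algebra.trace_eq_matrix_trace B, Matrix.trace_fin_two, Algebra.leftMulMatrix_eq_repr_mul,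
      Algebra.leftMulMatrix_eq_repr_mul, hr0, hr1]
    simp [-zsmul_eq_mul]
  have htr3 : Algebra.trace ℤ (𝓞 K) (ω * ω) = 2 * n + t * t := by
    have : ω * ω = n • (1 : 𝓞 K) + t • ω := by rw [← pow_two, hnt]; simp
    rw [this, map_add, map_smul, map_smul, htr1, htr2, smul_eq_mul, smul_eq_mul]; ring
  have hd : discr K = 4 * n + t ^ 2 := by
    rw [← discr_eq_discr K B, Algebra.discr_def, Matrix.det_fin_two]
    simp only [Algebra.traceMatrix_apply, Algebra.traceForm_apply, hB0, hB1, one_mul, mul_one,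
      htr1, htr2, htr3]
    ring
  rw [hd]
  push_cast
  linear_combination 4 * hnt

/-- Any π ∈ P \ P² works. If π = a + bω had ℓ ∣ b, then a ∈ P would force ℓ ∣ a, and π would lie in
ℓ𝓞_K = P². -/
theorem exists_uniformizer_of_isRamified {ℓ : ℕ} (hℓ : ℓ.Prime) (h : IsRamified K ℓ) :
    ∃ π : 𝓞 K, π ^ 2 ∈ Ideal.span {(ℓ : 𝓞 K)} ∧
      ∀ x : 𝓞 K, ∃ a b : ℤ, x - a - b * π ∈ Ideal.span {(ℓ : 𝓞 K)} := by
  obtain ⟨P, hP, h⟩ := h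
  have hne := span_natCast_ne_bot (K := K) hℓ.ne_zero
  have hP0 : P ≠ ⊥ := by rintro rfl; exact hne (by rw [h]; simp)
  have hlt : P ^ 2 < P ^ 1 := P.pow_right_strictAnti hP0 hP.ne_top one_lt_two
  rw [pow_one] at hlt
  obtain ⟨π, hπ, hπ2⟩ := SetLike.exists_of_lt hlt
  refine ⟨π, h ▸ Ideal.pow_mem_pow hπ 2, fun x => ?_⟩
  obtain ⟨ω, hω⟩ := exists_generator K
  obtain ⟨a, b, hab⟩ := hω π
  have hℓP : (ℓ : 𝓞 K) ∈ P := hlt.le (h ▸ Ideal.mem_span_singleton_self _)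
  have hb : ¬ (ℓ : ℤ) ∣ b := by
    rintro ⟨b', rfl⟩
    have ha : (a : 𝓞 K) ∈ P := by
      have : (a : 𝓞 K) = π - ℓ * (b' * ω) := by rw [hab]; push_cast; ring
      rw [this]
      exact P.sub_mem hπ (P.mul_mem_right _ hℓP)
    have haℓ : (ℓ : ℤ) ∣ a := by
      by_contra hndvd
      obtain ⟨a', k, hk⟩ := exists_int_mul_sub_one hℓ hndvd
      apply hP.ne_top
      rw [Ideal.eq_top_iff_one]
      have hk' : (a' : 𝓞 K) * a - 1 = ℓ * k := by exact_mod_cast congrArg (Int.cast : ℤ → 𝓞 K) hk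
      have : (1 : 𝓞 K) = a' * a - ℓ * k := by rw [← hk']; ring
      rw [this]
      exact P.sub_mem (P.mul_mem_left _ ha) (P.mul_mem_right _ hℓP)
    obtain ⟨a', rfl⟩ := haℓ
    apply hπ2
    rw [← h, Ideal.mem_span_singleton, hab]
    exact ⟨a' + b' * ω, by push_cast; ring⟩
  obtain ⟨b', k, hk⟩ := exists_int_mul_sub_one hℓ hb
  have hk' : (b' : 𝓞 K) * b - 1 = ℓ * k := by exact_mod_cast congrArg (Int.cast : ℤ → 𝓞 K) hk
  obtain ⟨c, d, rfl⟩ := hω x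
  refine ⟨c - d * b' * a, d * b', Ideal.mem_span_singleton.2 ⟨-(d * k * ω), ?_⟩⟩
  rw [hab]
  push_cast
  linear_combination -(d * ω) * hk'

end Quadratic

end QuadraticClassGroup

namespace QuadraticClassGroup

open Submodule NumberField

/-! ### The step criteria applied to the orders, with τ = mπ. -/

section OrderSteps

variable {K : Type*} [Field K]

theorem mem_order_of_eq {m : ℕ} {y : K} (x : 𝓞 K) (h : y = m * algebraMap (𝓞 K) K x) :
    y ∈ lattice (order K m) K :=
  span_mul_lattice_le_order m (mem_span_mul.2 ⟨_, mem_lattice.2 ⟨x, rfl⟩, h⟩)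

theorem mem_span_mul_order_of_eq {n m : ℕ} {y : K} (x : 𝓞 K)
    (h : y = n * (m * algebraMap (𝓞 K) K x)) : y ∈ span ℤ {(n : K)} * lattice (order K m) K :=
  mem_span_mul.2 ⟨_, mem_order_of_eq x rfl, h⟩

/-- The elements `1` and `π` generate the ring of integers modulo `ℓ`. -/
def GeneratesMod (ℓ : ℕ) (π : 𝓞 K) : Prop :=
  ∀ x : 𝓞 K, ∃ a b : ℤ, x - a - b * π ∈ Ideal.span {(ℓ : 𝓞 K)}

theorem GeneratesMod.lattice_order_le {ℓ : ℕ} {π : 𝓞 K} (h : GeneratesMod ℓ π) (m : ℕ) :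
    lattice (order K m) K ≤ 1 ⊔ (span ℤ {(m : K) * algebraMap (𝓞 K) K π} ⊔
      span ℤ {(ℓ : K)} * lattice (order K m) K) := by
  intro x hx
  rw [lattice_order] at hx
  obtain ⟨n, hn⟩ := mem_one_sup.1 hx
  obtain ⟨_, hy, hy'⟩ := mem_span_mul.1 hn
  obtain ⟨y, rfl⟩ := mem_lattice.1 hy
  obtain ⟨a, b, hab⟩ := h y
  obtain ⟨z, hz⟩ := Ideal.mem_span_singleton.1 hab
  refine mem_one_sup.2 ⟨n + m * a, mem_span_sup.2 ⟨b, mem_span_mul_order_of_eq z ?_⟩⟩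
  have hz' := congrArg (algebraMap (𝓞 K) K) hz
  simp only [map_sub, map_mul, map_intCast, map_natCast] at hz'
  push_cast
  linear_combination hy' + (m : K) * hz'

variable [NumberField K] {ℓ : ℕ} [Fact ℓ.Prime] {m m' m'' : ℕ}

/-- `hπ2` holds in two situations: ℓ ∣ m with any π, or π² ∈ ℓ𝓞_K with any m. -/
theorem rk_order_eq_or (hm : m ≠ 0) (hm' : m' = ℓ * m) {π : 𝓞 K} (hπ : GeneratesMod ℓ π)
    (hπ2 : ∃ x : 𝓞 K, (m : 𝓞 K) * π ^ 2 = ℓ * x) :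
    rk ℓ (CommGroup.primaryComponent (ClassGroup (order K m')) ℓ) =
        rk ℓ (CommGroup.primaryComponent (ClassGroup (order K m)) ℓ) ∨
      rk ℓ (CommGroup.primaryComponent (ClassGroup (order K m')) ℓ) =
        rk ℓ (CommGroup.primaryComponent (ClassGroup (order K m)) ℓ) + 1 := by
  have hℓ : ℓ.Prime := Fact.out
  subst hm'
  have hm' : ℓ * m ≠ 0 := mul_ne_zero hℓ.ne_zero hm
  have : NeZero m := ⟨hm⟩
  have : NeZero (ℓ * m) := ⟨hm'⟩
  have := finite_classGroup_order (K := K) m hm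
  have := finite_classGroup_order (K := K) _ hm'
  have := finite_quotient_order (K := K) m hℓ.ne_zero
  obtain ⟨x, hx⟩ := hπ2
  refine rk_step_eq_or (lattice_order_mul ℓ m) (one_notMem_span_mul_order hℓ m)
    (finite_maximal_of_finite_quotient ℓ) (mem_order_of_eq π rfl) (hπ.lattice_order_le m)
    (mem_span_mul_order_of_eq x ?_)
  have hx' := congrArg (algebraMap (𝓞 K) K) hx
  simp only [map_pow, map_mul, map_natCast] at hx'
  linear_combination (m : K) * hx'

theorem rk_order_eq_of_coprime (hm : m ≠ 0) (hm' : m' = ℓ * m) (hcop : m.Coprime ℓ)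
    (hpow : ∀ u : 𝓞 K, u ^ ℓ ^ 2 - u ∈ Ideal.span {(ℓ : 𝓞 K)}) :
    rk ℓ (CommGroup.primaryComponent (ClassGroup (order K m')) ℓ) =
      rk ℓ (CommGroup.primaryComponent (ClassGroup (order K m)) ℓ) := by
  have hℓ : ℓ.Prime := Fact.out
  subst hm'
  have hm' : ℓ * m ≠ 0 := mul_ne_zero hℓ.ne_zero hm
  have : NeZero m := ⟨hm⟩
  have : NeZero (ℓ * m) := ⟨hm'⟩
  have := finite_classGroup_order (K := K) m hm
  have := finite_classGroup_order (K := K) _ hm'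
  have := finite_quotient_order (K := K) m hℓ.ne_zero
  have hΛ := isRingLattice_lattice (order K m) K
  refine rk_step_eq_of_pow_sub_mem (lattice_order_mul ℓ m) (one_notMem_span_mul_order hℓ m)
    (finite_maximal_of_finite_quotient ℓ) fun u hu => ?_
  obtain ⟨v, rfl⟩ := mem_lattice.1 (lattice_order_le m hu)
  obtain ⟨w, hw⟩ := Ideal.mem_span_singleton.1 (hpow v)
  have hw' := congrArg (algebraMap (𝓞 K) K) hw
  simp only [map_sub, map_pow, map_mul, map_natCast] at hw'
  refine mem_span_mul.2 ⟨algebraMap (𝓞 K) K w, ?_, hw'⟩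
  -- Both mw and ℓw lie in the order, so w does too, as m and ℓ are coprime.
  obtain ⟨a, b, hab⟩ := Nat.isCoprime_iff_coprime.2 hcop
  have hab' : (a : K) * m + b * ℓ = 1 := by simpa using congrArg (Int.cast : ℤ → K) hab
  have h1 : algebraMap (𝓞 K) K w = a * (m * algebraMap (𝓞 K) K w) +
      b * (algebraMap (𝓞 K) K v ^ ℓ ^ 2 - algebraMap (𝓞 K) K v) := by
    rw [hw']; linear_combination -(algebraMap (𝓞 K) K w) * hab'
  rw [h1]
  exact add_mem (intCast_mul_mem (mem_order_of_eq w rfl) a)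
    (intCast_mul_mem (sub_mem (hΛ.pow_mem hu _) hu) b)

theorem rk_order_eq_of_pow_eq (hm : m ≠ 0) (hm' : m' = ℓ * m) (hm'' : m'' = ℓ * m') {π : 𝓞 K}
    (hπ : GeneratesMod ℓ π) (hπ2 : ∃ x : 𝓞 K, (m : 𝓞 K) * π ^ 2 = ℓ * x)
    {k : ℕ} (hk : ¬ ℓ ∣ k)
    (hpow : (1 + (m : K) * algebraMap (𝓞 K) K π) ^ ℓ -
      (1 + k * (ℓ * (m * algebraMap (𝓞 K) K π))) ∈
        span ℤ {((ℓ ^ 2 : ℕ) : K)} * lattice (order K m) K) :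
    rk ℓ (CommGroup.primaryComponent (ClassGroup (order K m'')) ℓ) =
      rk ℓ (CommGroup.primaryComponent (ClassGroup (order K m')) ℓ) := by
  have hℓ : ℓ.Prime := Fact.out
  subst hm'
  subst hm''
  have hm' : ℓ * m ≠ 0 := mul_ne_zero hℓ.ne_zero hm
  have hm'' : ℓ * (ℓ * m) ≠ 0 := mul_ne_zero hℓ.ne_zero hm'
  have : NeZero (ℓ * m) := ⟨hm'⟩
  have : NeZero (ℓ * (ℓ * m)) := ⟨hm''⟩
  have := finite_classGroup_order (K := K) _ hm'
  have := finite_classGroup_order (K := K) _ hm''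
  have := finite_quotient_order (K := K) (ℓ * m) hℓ.ne_zero
  obtain ⟨x, hx⟩ := hπ2
  refine rk_step_eq_of_pow_eq (C := order K m) (lattice_order_mul ℓ (ℓ * m))
    (lattice_order_mul ℓ m) (one_notMem_span_mul_order hℓ _)
    (finite_maximal_of_finite_quotient ℓ) (mem_order_of_eq π rfl) (hπ.lattice_order_le m)
    (mem_span_mul_order_of_eq x ?_) hk hpow
  have hx' := congrArg (algebraMap (𝓞 K) K) hx
  simp only [map_pow, map_mul, map_natCast] at hx'
  linear_combination (m : K) * hx'

theorem rk_order_eq_of_pow_mem (hm : m ≠ 0) (hm' : m' = ℓ * m) (hm'' : m'' = ℓ * m') {π : 𝓞 K}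
    (hπ : GeneratesMod ℓ π) (hπ2 : ∃ x : 𝓞 K, (m : 𝓞 K) * π ^ 2 = ℓ * x)
    (hπℓ : ((m : K) * algebraMap (𝓞 K) K π) ^ ℓ ∈
      span ℤ {((ℓ ^ 2 : ℕ) : K)} * lattice (order K m) K) :
    rk ℓ (CommGroup.primaryComponent (ClassGroup (order K m'')) ℓ) =
      rk ℓ (CommGroup.primaryComponent (ClassGroup (order K m')) ℓ) := by
  have hℓ : ℓ.Prime := Fact.out
  refine rk_order_eq_of_pow_eq hm hm' hm'' hπ hπ2 (k := 1) hℓ.not_dvd_one ?_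
  rw [Nat.cast_one, one_mul]
  obtain ⟨x, hx⟩ := hπ2
  refine one_add_pow_prime_sub_mem (isRingLattice_lattice _ _) hℓ (mem_order_of_eq π rfl)
    (mem_span_mul_order_of_eq x ?_) hπℓ
  have hx' := congrArg (algebraMap (𝓞 K) K) hx
  simp only [map_pow, map_mul, map_natCast] at hx'
  linear_combination (m : K) * hx'

/-- With m = ℓn, (mω)³ = ℓ² · m · n²ω³: two factors m supply ℓ², and the third keeps the cofactor in
the order. This is where ℓ ≥ 3 enters. -/
theorem rk_order_eq_of_dvd (hℓ3 : 3 ≤ ℓ) (hm : m ≠ 0) (hdvd : ℓ ∣ m) (hm' : m' = ℓ * m)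
    (hm'' : m'' = ℓ * m') {ω : 𝓞 K} (hω : GeneratesMod ℓ ω) :
    rk ℓ (CommGroup.primaryComponent (ClassGroup (order K m'')) ℓ) =
      rk ℓ (CommGroup.primaryComponent (ClassGroup (order K m')) ℓ) := by
  obtain ⟨n, hn⟩ := hdvd
  have hnK : (m : K) = ℓ * n := by rw [hn]; push_cast; rfl
  refine rk_order_eq_of_pow_mem hm hm' hm'' hω ⟨n * ω ^ 2, by rw [hn]; push_cast; ring⟩ ?_
  obtain ⟨j, hj⟩ := Nat.exists_eq_add_of_le hℓ3
  have hpow : ((m : K) * algebraMap (𝓞 K) K ω) ^ ℓ =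
      ((m : K) * algebraMap (𝓞 K) K ω) ^ 3 * ((m : K) * algebraMap (𝓞 K) K ω) ^ j := by
    rw [← pow_add, ← hj]
  rw [hpow]
  have hΛ := isRingLattice_lattice (order K m) K
  refine hΛ.smul_mem_right (mem_span_mul_order_of_eq (n ^ 2 * ω ^ 3) ?_)
    (hΛ.pow_mem (mem_order_of_eq ω rfl) j)
  rw [mul_pow, pow_succ (m : K) 2, hnK]
  simp only [map_pow, map_mul, map_natCast]
  push_cast
  ring

/-- π⁴ ∈ ℓ²𝓞_K, and the exponent ℓ ≥ 5 provides these four factors. -/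
theorem rk_order_eq_of_sq_mem (hℓ5 : 5 ≤ ℓ) (hm : m ≠ 0) (hm' : m' = ℓ * m)
    (hm'' : m'' = ℓ * m') {π : 𝓞 K} (hπ : GeneratesMod ℓ π)
    (hπ2 : π ^ 2 ∈ Ideal.span {(ℓ : 𝓞 K)}) :
    rk ℓ (CommGroup.primaryComponent (ClassGroup (order K m'')) ℓ) =
      rk ℓ (CommGroup.primaryComponent (ClassGroup (order K m')) ℓ) := by
  obtain ⟨x, hx⟩ := Ideal.mem_span_singleton.1 hπ2
  have hx' := congrArg (algebraMap (𝓞 K) K) hx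
  simp only [map_pow, map_mul, map_natCast] at hx'
  refine rk_order_eq_of_pow_mem hm hm' hm'' hπ ⟨m * x, by rw [hx]; ring⟩ ?_
  obtain ⟨j, hj⟩ := Nat.exists_eq_add_of_le (show 4 ≤ ℓ by lia)
  have hpow : ((m : K) * algebraMap (𝓞 K) K π) ^ ℓ =
      ((m : K) * algebraMap (𝓞 K) K π) ^ 4 * ((m : K) * algebraMap (𝓞 K) K π) ^ j := by
    rw [← pow_add, ← hj]
  rw [hpow]
  have hΛ := isRingLattice_lattice (order K m) K
  refine hΛ.smul_mem_right (mem_span_mul_order_of_eq (m ^ 3 * x ^ 2) ?_)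
    (hΛ.pow_mem (mem_order_of_eq π rfl) j)
  have h4 : (algebraMap (𝓞 K) K π) ^ 4 = (ℓ * algebraMap (𝓞 K) K x) ^ 2 := by
    rw [← hx']; ring
  rw [mul_pow, h4]
  simp only [map_pow, map_mul, map_natCast]
  push_cast
  ring

/-- With π² = D ≡ 3 mod 9, (1 + mπ)³ = 1 + 3mπ + 3m²D + m³Dπ ≡ 1 + 3(1 + m²)mπ modulo 9, and 1 + m²
≡ 2 mod 3. For D ≡ 6 the factor would be 1 + 2m², divisible by 3, and the argument fails. -/
theorem rk_order_eq_of_discr_mod_nine [Fact (Nat.Prime 3)] (hm : m ≠ 0) (hcop : m.Coprime 3)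
    (hm' : m' = 3 * m) (hm'' : m'' = 3 * m') {π : 𝓞 K} (hπ : GeneratesMod 3 π)
    {D : ℤ} (hπ2 : π ^ 2 = D) (hD : D ≡ 3 [ZMOD 9]) :
    rk 3 (CommGroup.primaryComponent (ClassGroup (order K m'')) 3) =
      rk 3 (CommGroup.primaryComponent (ClassGroup (order K m')) 3) := by
  obtain ⟨e, he⟩ := hD.symm.dvd
  have heD : D = 9 * e + 3 := by linarith
  have hπ2' := congrArg (algebraMap (𝓞 K) K) hπ2
  simp only [map_pow, map_intCast, heD] at hπ2'
  push_cast at hπ2'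
  refine rk_order_eq_of_pow_eq hm hm' hm'' hπ (k := 1 + m ^ 2)
    ⟨m * (3 * e + 1), by rw [hπ2, heD]; push_cast; ring⟩ ?_ ?_
  · have h3 : m % 3 = 1 ∨ m % 3 = 2 := by
      have : ¬ 3 ∣ m := fun h => by
        have := Nat.dvd_gcd h dvd_rfl
        rw [hcop] at this
        lia
      lia
    rw [Nat.dvd_iff_mod_eq_zero, Nat.add_mod, Nat.pow_mod]
    rcases h3 with h | h <;> rw [h] <;> decide
  · refine mem_span_mul_order_of_eq (m * (3 * e + 1) + e * m ^ 2 * π) ?_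
    simp only [map_add, map_mul, map_pow, map_natCast, map_intCast, map_one, map_ofNat]
    push_cast
    linear_combination (3 * (m : K) ^ 2 + m ^ 3 * algebraMap (𝓞 K) K π) * hπ2'

end OrderSteps

theorem generatesMod_of_forall_eq {K : Type*} [Field K] (ℓ : ℕ) {ω : 𝓞 K}
    (h : ∀ x : 𝓞 K, ∃ a b : ℤ, x = a + b * ω) : GeneratesMod ℓ ω := by
  intro x
  obtain ⟨a, b, rfl⟩ := h x
  exact ⟨a, b, by simp⟩

theorem exists_sq_eq_discr_generatesMod (K : Type*) [Field K] [NumberField K]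
    [Algebra.IsQuadraticExtension ℚ K] :
    ∃ π : 𝓞 K, π ^ 2 = (discr K : 𝓞 K) ∧ GeneratesMod 3 π := by
  obtain ⟨ω, t, hω, ht⟩ := exists_sq_eq_discr K
  refine ⟨2 * ω - t, ht, fun x => ?_⟩
  obtain ⟨a, b, rfl⟩ := hω x
  -- Since 2 ≡ -1 mod 3, ω ≡ -t - (2ω - t) modulo 3.
  exact ⟨a - b * t, -b, Ideal.mem_span_singleton.2 ⟨b * ω, by push_cast; ring⟩⟩

end QuadraticClassGroup

theorem mainTheorem10 (K : Type*) [Field K] [NumberField K]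
    [Algebra.IsQuadraticExtension ℚ K] [NumberField.IsTotallyComplex K]
    (ℓ : ℕ) [Fact ℓ.Prime] (hℓ : 3 ≤ ℓ) (c : ℕ) (hc : 1 ≤ c) (hcℓ : c.Coprime ℓ) :
    (QuadraticClassGroup.IsSplit K ℓ ∨ QuadraticClassGroup.IsInert K ℓ →
      QuadraticClassGroup.rk ℓ (QuadraticClassGroup.S K ℓ c 1) =
          QuadraticClassGroup.rk ℓ (QuadraticClassGroup.S K ℓ c 0) ∧
      (QuadraticClassGroup.rk ℓ (QuadraticClassGroup.S K ℓ c 2) =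
          QuadraticClassGroup.rk ℓ (QuadraticClassGroup.S K ℓ c 0) ∨
        QuadraticClassGroup.rk ℓ (QuadraticClassGroup.S K ℓ c 2) =
          QuadraticClassGroup.rk ℓ (QuadraticClassGroup.S K ℓ c 0) + 1) ∧
      ∀ d : ℕ, 2 ≤ d →
        QuadraticClassGroup.rk ℓ (QuadraticClassGroup.S K ℓ c d) =
          QuadraticClassGroup.rk ℓ (QuadraticClassGroup.S K ℓ c 2)) ∧
    (QuadraticClassGroup.IsRamified K ℓ →
      (5 ≤ ℓ ∨ (ℓ = 3 ∧ NumberField.discr K ≡ 3 [ZMOD 9])) →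
      (QuadraticClassGroup.rk ℓ (QuadraticClassGroup.S K ℓ c 1) =
          QuadraticClassGroup.rk ℓ (QuadraticClassGroup.S K ℓ c 0) ∨
        QuadraticClassGroup.rk ℓ (QuadraticClassGroup.S K ℓ c 1) =
          QuadraticClassGroup.rk ℓ (QuadraticClassGroup.S K ℓ c 0) + 1) ∧
      ∀ d : ℕ, 1 ≤ d →
        QuadraticClassGroup.rk ℓ (QuadraticClassGroup.S K ℓ c d) =
          QuadraticClassGroup.rk ℓ (QuadraticClassGroup.S K ℓ c 1)) ∧
    (QuadraticClassGroup.IsRamified K ℓ → ℓ = 3 → NumberField.discr K ≡ 6 [ZMOD 9] →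
      (QuadraticClassGroup.rk ℓ (QuadraticClassGroup.S K ℓ c 1) =
          QuadraticClassGroup.rk ℓ (QuadraticClassGroup.S K ℓ c 0) ∨
        QuadraticClassGroup.rk ℓ (QuadraticClassGroup.S K ℓ c 1) =
          QuadraticClassGroup.rk ℓ (QuadraticClassGroup.S K ℓ c 0) + 1) ∧
      (QuadraticClassGroup.rk ℓ (QuadraticClassGroup.S K ℓ c 2) =
          QuadraticClassGroup.rk ℓ (QuadraticClassGroup.S K ℓ c 1) ∨
        QuadraticClassGroup.rk ℓ (QuadraticClassGroup.S K ℓ c 2) =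
          QuadraticClassGroup.rk ℓ (QuadraticClassGroup.S K ℓ c 1) + 1) ∧
      ∀ d : ℕ, 2 ≤ d →
        QuadraticClassGroup.rk ℓ (QuadraticClassGroup.S K ℓ c d) =
          QuadraticClassGroup.rk ℓ (QuadraticClassGroup.S K ℓ c 2)) := by
  have hℓ' : ℓ.Prime := Fact.out
  have hm : ∀ d, c * ℓ ^ d ≠ 0 := fun d =>
    mul_ne_zero (Nat.one_le_iff_ne_zero.1 hc) (pow_ne_zero _ hℓ'.ne_zero)
  have hs : ∀ d, c * ℓ ^ (d + 1) = ℓ * (c * ℓ ^ d) := fun d => by ring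
  have hcop : (c * ℓ ^ 0).Coprime ℓ := by rwa [pow_zero, mul_one]
  obtain ⟨ω, hω⟩ := QuadraticClassGroup.exists_generator K
  have hωg := QuadraticClassGroup.generatesMod_of_forall_eq ℓ hω
  -- From level 1 on ℓ divides the conductor, so this needs nothing about how ℓ decomposes in K; the
  -- same holds for `htwo`.
  have hstable : ∀ d : ℕ, 2 ≤ d → QuadraticClassGroup.rk ℓ (QuadraticClassGroup.S K ℓ c d) =
      QuadraticClassGroup.rk ℓ (QuadraticClassGroup.S K ℓ c 2) := by
    intro d hd
    induction d, hd using Nat.le_induction with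
    | base => rfl
    | succ d hd ih =>
      obtain ⟨e, rfl⟩ := Nat.exists_eq_add_of_le' hd
      rw [← ih]
      exact QuadraticClassGroup.rk_order_eq_of_dvd hℓ (hm (e + 1)) ⟨c * ℓ ^ e, hs e⟩
        (hs (e + 1)) (hs (e + 2)) hωg
  have htwo : QuadraticClassGroup.rk ℓ (QuadraticClassGroup.S K ℓ c 2) =
        QuadraticClassGroup.rk ℓ (QuadraticClassGroup.S K ℓ c 1) ∨
      QuadraticClassGroup.rk ℓ (QuadraticClassGroup.S K ℓ c 2) =
        QuadraticClassGroup.rk ℓ (QuadraticClassGroup.S K ℓ c 1) + 1 :=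
    QuadraticClassGroup.rk_order_eq_or (hm 1) (hs 1) hωg
      ⟨c * ω ^ 2, by push_cast; ring⟩
  have hone : QuadraticClassGroup.IsRamified K ℓ →
      QuadraticClassGroup.rk ℓ (QuadraticClassGroup.S K ℓ c 1) =
          QuadraticClassGroup.rk ℓ (QuadraticClassGroup.S K ℓ c 0) ∨
        QuadraticClassGroup.rk ℓ (QuadraticClassGroup.S K ℓ c 1) =
          QuadraticClassGroup.rk ℓ (QuadraticClassGroup.S K ℓ c 0) + 1 := by
    intro hr
    obtain ⟨π, hπ2, hπ⟩ := QuadraticClassGroup.exists_uniformizer_of_isRamified hℓ' hr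
    obtain ⟨x, hx⟩ := Ideal.mem_span_singleton.1 hπ2
    exact QuadraticClassGroup.rk_order_eq_or (hm 0) (hs 0) hπ
      ⟨(c * ℓ ^ 0 : ℕ) * x, by rw [hx]; ring⟩
  refine ⟨fun h => ?_, fun hr h => ⟨hone hr, ?_⟩, fun hr _ _ => ⟨hone hr, htwo, hstable⟩⟩
  · have h01 : QuadraticClassGroup.rk ℓ (QuadraticClassGroup.S K ℓ c 1) =
        QuadraticClassGroup.rk ℓ (QuadraticClassGroup.S K ℓ c 0) :=
      QuadraticClassGroup.rk_order_eq_of_coprime (hm 0) (hs 0) hcop fun u =>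
        h.elim (fun h => QuadraticClassGroup.pow_sq_sub_mem_of_isSplit hℓ' h u)
          fun h => QuadraticClassGroup.pow_sq_sub_mem_of_isInert hℓ' h u
    exact ⟨h01, h01 ▸ htwo, hstable⟩
  · have h12 : QuadraticClassGroup.rk ℓ (QuadraticClassGroup.S K ℓ c 2) =
        QuadraticClassGroup.rk ℓ (QuadraticClassGroup.S K ℓ c 1) := by
      rcases h with h5 | ⟨rfl, hD⟩
      · obtain ⟨π, hπ2, hπ⟩ := QuadraticClassGroup.exists_uniformizer_of_isRamified hℓ' hr
        exact QuadraticClassGroup.rk_order_eq_of_sq_mem h5 (hm 0) (hs 0) (hs 1) hπ hπ2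
      · obtain ⟨π, hπ2, hπ⟩ := QuadraticClassGroup.exists_sq_eq_discr_generatesMod K
        exact QuadraticClassGroup.rk_order_eq_of_discr_mod_nine (hm 0) hcop (hs 0) (hs 1) hπ hπ2 hD
    intro d hd
    rcases hd.eq_or_lt with rfl | hd
    · rfl
    · rw [hstable d hd, h12]
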